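/- Conventions. Manifolds, vector fields, metrics and tensor fields are smooth. Fix $\epsilon\in\{-1,1\}$ and a Riemannian manifold $(\overline M,g)$ with a $(1,1)$-tensor field $\varphi$ such that $g(\varphi X,Y)=\epsilon\, g(X,\varphi Y)$ for all vector fields $X,Y$, in one of two settings: (a) $\varphi^2=\epsilon I$ (almost Hermitian or almost product Riemannian), or (b) $\varphi^2=\epsilon(I-\eta\otimes\xi)$, where $\xi$ is a fixed unit vector field on $\overline M$ and $\eta=g(\cdot,\xi)$ (almost contact metric or almost paracontact metric). Let $M$ be an immersed submanifold of $\overline M$ (possibly of the same dimension), tangent to $\xi$ in setting (b), with the induced metric. In setting (a) put $\langle\xi\rangle=\{0\}$. A regular distribution on $M$ is a smooth distribution of constant rank. For a distribution $D$ on $M$ and a vector $v$ tangent to $M$, $fv$ denotes the orthogonal projection of $\varphi v$ on $D$. Let $k\ge 1$. $M$ is a $k$-pointwise slant submanifold if there are an orthogonal decomposition $TM=D_0\oplus D_1\oplus\dots\oplus D_k\oplus\langle\xi\rangle$ into regular distributions, with $D_1,\dots,D_k$ non-null and $D_0$ possibly null, and $k$ distinct continuous functions $\theta_i:M\to(0,\frac{\pi}{2}]$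 such that, for $D=D_0\oplus\dots\oplus D_k$: (i) for all $i\ge1$, $x\in M$ and $v\in (D_i)_x\setminus\{0\}$ one has $\varphi v\ne0$ and the angle between $\varphi v$ and $(D_i)_x$ is $\theta_i(x)$; (ii) $\varphi(D_0)\subseteq D_0$; (iii) $f(D_i)\subseteq D_i$ for $i\ge1$. It is a $k$-slant submanifold if there is such a decomposition with distinct constants $\theta_1,\dots,\theta_k$. An open subset of $M$ is regarded as a submanifold of $\overline M$ in the same way. Theorem. Let $M$ be a $k$-pointwise slant submanifold of $\overline M$, with a decomposition and slant functions as above, let $f$ be the component of $\varphi$ into $D=D_0\oplus\dots\oplus D_k$, let $\lambda_i=\epsilon\cos^2\theta_i$ (the eigenvalue of $f^2$ on $D_i$), $i=1,\dots,k$, and let $\nabla$ be the Levi-Civita connection of the induced metric of $M$. Consider 1) $(\nabla_Xf^2)Y:=\nabla_X(f^2Y)-f^2(\nabla_XY)=0$ for all vector fields $X$ on $M$ and all vector fields $Y\in D_1\oplus\dots\oplus D_k$; 2) i) $f^2(\nabla_XY)=\lambda_i\nabla_XY$ for all vector fields $X$ on $M$ and all vector fields $Y\in D_i$, $i=1,\dots,k$.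 (A) Assertion 1) is equivalent to the conjunction of 2) i) and: every connected component of $M$ is a $k'$-slant submanifold of $\overline M$ for some $k'\in\{1,\dots,k\}$ (which may depend on the component). It is also equivalent to the conjunction of 2) i) and: on every connected component $C$ of $M$ all the functions $\lambda_i$ are constant, and $C$ is a $k'$-slant submanifold with $k'$ the number of distinct values of $\lambda_1,\dots,\lambda_k$ on $C$. (B) If $M$ is connected, then assertion 1) is equivalent to the conjunction of 2) i) and: $M$ is a $k$-slant submanifold of $\overline M$. It is also equivalent to the conjunction of 2) i) and: $M$ is a $k$-slant submanifold of $\overline M$ and $\lambda_1,\dots,\lambda_k$ are constant and pairwise different on $M$. -/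

import Mathlib

open Bundle Manifold
open scoped ContDiff

/-! ### The Levi-Civita connection of a Riemannian manifold -/

section

variable {E : Type*} [NormedAddCommGroup E] [NormedSpace ℝ E]
  {H : Type*} [TopologicalSpace H] (I : ModelWithCorners ℝ E H)
  {M : Type*} [TopologicalSpace M] [ChartedSpace H M]

instance tangentSpace_finiteDimensional [FiniteDimensional ℝ E] (x : M) :
    FiniteDimensional ℝ (TangentSpace I x) :=
  inferInstanceAs (FiniteDimensional ℝ E)

variable [IsManifold I 1 M] [RiemannianBundle (fun x : M => TangentSpace I x)]

/-- The Koszul expression: for the Levi-Civita connection it is equal to `2 g(∇_X Y, W)`. -/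
noncomputable def koszulForm (X Y W : ∀ x : M, TangentSpace I x) (x : M) : ℝ :=
  mvfderiv I (fun y => inner ℝ (Y y) (W y)) x (X x)
    + mvfderiv I (fun y => inner ℝ (X y) (W y)) x (Y x)
    - mvfderiv I (fun y => inner ℝ (X y) (Y y)) x (W x)
    + inner ℝ (VectorField.mlieBracket I X Y x) (W x)
    - inner ℝ (VectorField.mlieBracket I X W x) (Y x)
    - inner ℝ (VectorField.mlieBracket I Y W x) (X x)

/-- The Levi-Civita connection of the Riemannian metric carried by the tangent spaces;
`leviCivita I Y x v` is `∇_v Y` at the point `x`. It is given by the Koszul formula, evaluated on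
local extensions of the vectors of an orthonormal basis of the tangent space at `x`. See
`inner_leviCivita`, `isCovariantDerivativeOn_leviCivita`, `leviCivita_torsionFree` and
`leviCivita_metric` below for its characteristic properties. -/
noncomputable def leviCivita [FiniteDimensional ℝ E] (Y : ∀ x : M, TangentSpace I x) (x : M) :
    TangentSpace I x →L[ℝ] TangentSpace I x :=
  let e := stdOrthonormalBasis ℝ (TangentSpace I x)
  ∑ i, ∑ j, ((1 / 2 : ℝ) *
      koszulForm I (FiberBundle.extend E (e i)) Y (FiberBundle.extend E (e j)) x) •
    (innerSL ℝ (e i)).smulRight (e j)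

end

section
variable {E : Type*} [NormedAddCommGroup E] [NormedSpace ℝ E] [FiniteDimensional ℝ E]
  {H : Type*} [TopologicalSpace H] {I : ModelWithCorners ℝ E H}
  {M : Type*} [TopologicalSpace M] [ChartedSpace H M] [IsManifold I ∞ M]
  [RiemannianBundle (fun x : M => TangentSpace I x)]
  [IsContMDiffRiemannianBundle I ∞ E (fun x : M => TangentSpace I x)]
  {X Y Z W : ∀ x : M, TangentSpace I x} {x : M}

lemma mdiff_inner (hY : MDiffAt (T% Y) x) (hZ : MDiffAt (T% Z) x) :
    MDiffAt (fun y => inner ℝ (Y y) (Z y)) x := by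
  have : IsContMDiffRiemannianBundle I 1 E (fun x : M => TangentSpace I x) :=
    IsContMDiffRiemannianBundle.of_le (n := ∞) (by norm_cast)
  exact MDifferentiableAt.inner_bundle (F := E) (E := fun x : M => TangentSpace I x) hY hZ

lemma koszul_tensorial₁ (hY : MDiffAt (T% Y) x) (hW : MDiffAt (T% W) x) :
    TensorialAt I E (fun X => koszulForm I X Y W x) x where
  smul {f X} hf hX := by
    have : IsManifold I 2 M := .of_le (n := ∞) (by norm_cast)
    have : CompleteSpace E := FiniteDimensional.complete ℝ E
    have h1 := mvfderiv_fun_mul hf (mdiff_inner hX hW)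
    have h2 := mvfderiv_fun_mul hf (mdiff_inner hX hY)
    simp [koszulForm, VectorField.mlieBracket_smul_left hf hX, inner_smul_left, h1, h2,
      inner_add_left, inner_smul_right]
    ring
  add {X X'} hX hX' := by
    have : IsManifold I 2 M := .of_le (n := ∞) (by norm_cast)
    have : CompleteSpace E := FiniteDimensional.complete ℝ E
    have h1 := mvfderiv_fun_add (mdiff_inner hX hW) (mdiff_inner hX' hW)
    have h2 := mvfderiv_fun_add (mdiff_inner hX hY) (mdiff_inner hX' hY)
    simp [koszulForm, VectorField.mlieBracket_add_left hX hX', h1, h2,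
      inner_add_left, inner_add_right]
    ring

lemma koszul_tensorial₂ (hX : MDiffAt (T% X) x) (hY : MDiffAt (T% Y) x) :
    TensorialAt I E (fun W => koszulForm I X Y W x) x where
  smul {f W} hf hW := by
    have : IsManifold I 2 M := .of_le (n := ∞) (by norm_cast)
    have : CompleteSpace E := FiniteDimensional.complete ℝ E
    have h1 := mvfderiv_fun_mul hf (mdiff_inner hX hW)
    have h2 := mvfderiv_fun_mul hf (mdiff_inner hY hW)
    simp [koszulForm, VectorField.mlieBracket_smul_right hf hW, inner_smul_left, h1, h2,
      inner_add_left, inner_smul_right, real_inner_comm]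
    ring
  add {W W'} hW hW' := by
    have : IsManifold I 2 M := .of_le (n := ∞) (by norm_cast)
    have : CompleteSpace E := FiniteDimensional.complete ℝ E
    have h1 := mvfderiv_fun_add (mdiff_inner hX hW) (mdiff_inner hX hW')
    have h2 := mvfderiv_fun_add (mdiff_inner hY hW) (mdiff_inner hY hW')
    simp [koszulForm, VectorField.mlieBracket_add_right hW hW', h1, h2,
      inner_add_left, inner_add_right]
    ring

theorem inner_leviCivita (hX : MDiffAt (T% X) x) (hY : MDiffAt (T% Y) x)
    (hW : MDiffAt (T% W) x) :
    inner ℝ (leviCivita I Y x (X x)) (W x) = (1 / 2 : ℝ) * koszulForm I X Y W x := by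
  have : ContMDiffVectorBundle 1 E (TangentSpace I : M → Type _) I :=
    have : IsManifold I (1 + 1) M := .of_le (n := ∞) (by norm_cast)
    TangentBundle.contMDiffVectorBundle
  have ext (v : TangentSpace I x) : MDiffAt (T% (FiberBundle.extend E v)) x :=
    FiberBundle.mdifferentiableAt_extend I E v
  let e := stdOrthonormalBasis ℝ (TangentSpace I x)
  have hX' : koszulForm I X Y W x =
      ∑ i, inner ℝ (e i) (X x) * koszulForm I (FiberBundle.extend E (e i)) Y W x := by
    have h := TensorialAt.mkHom_apply (koszul_tensorial₁ hY hW) hX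
    have h' (i) := TensorialAt.mkHom_apply (koszul_tensorial₁ hY hW) (ext (e i))
    simp only [FiberBundle.extend_apply_self] at h'
    simp_rw [← h', ← h]
    conv_lhs => rw [← e.sum_repr' (X x)]
    simp
  have hW' (Z : ∀ x : M, TangentSpace I x) (hZ : MDiffAt (T% Z) x) : koszulForm I Z Y W x =
      ∑ i, inner ℝ (e i) (W x) * koszulForm I Z Y (FiberBundle.extend E (e i)) x := by
    have h := TensorialAt.mkHom_apply (koszul_tensorial₂ hZ hY) hW
    have h' (i) := TensorialAt.mkHom_apply (koszul_tensorial₂ hZ hY) (ext (e i))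
    simp only [FiberBundle.extend_apply_self] at h'
    simp_rw [← h', ← h]
    conv_lhs => rw [← e.sum_repr' (W x)]
    simp
  rw [hX']
  simp_rw [hW' _ (ext _)]
  simp only [leviCivita, sum_apply, sum_inner, Finset.mul_sum,
    smul_apply, ContinuousLinearMap.smulRight_apply, inner_smul_left]
  refine Finset.sum_congr rfl fun i _ => Finset.sum_congr rfl fun j _ => ?_
  simp [e]
  ring

lemma leviCivita_ext {a b : TangentSpace I x}
    (h : ∀ W : ∀ x : M, TangentSpace I x, MDiffAt (T% W) x → inner ℝ a (W x) = inner ℝ b (W x)) :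
    a = b := by
  refine ext_inner_right ℝ fun v => ?_
  simpa using h (FiberBundle.extend E v) (FiberBundle.mdifferentiableAt_extend I E v)

theorem isCovariantDerivativeOn_leviCivita :
    IsCovariantDerivativeOn E (leviCivita I (M := M)) Set.univ where
  add {Y Y' x} hY hY' _ := by
    have : IsManifold I 2 M := .of_le (n := ∞) (by norm_cast)
    have : CompleteSpace E := FiniteDimensional.complete ℝ E
    ext1 v
    have hX := FiberBundle.mdifferentiableAt_extend I E v
    refine leviCivita_ext fun W hW => ?_
    have e1 := inner_leviCivita hX (mdifferentiableAt_add_section hY hY') hW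
    have e2 := inner_leviCivita hX hY hW
    have e3 := inner_leviCivita hX hY' hW
    simp only [FiberBundle.extend_apply_self] at e1 e2 e3
    have h1 := mvfderiv_fun_add (mdiff_inner hY hW) (mdiff_inner hY' hW)
    have h2 := mvfderiv_fun_add (mdiff_inner hX hY) (mdiff_inner hX hY')
    rw [add_apply, inner_add_left, e2, e3]
    refine e1.trans ?_
    simp [koszulForm, VectorField.mlieBracket_add_left hY hY',
      VectorField.mlieBracket_add_right hY hY', h1, h2, inner_add_left, inner_add_right]
    ring
  leibniz {Y f x} hY hf _ := by
    have : IsManifold I 2 M := .of_le (n := ∞) (by norm_cast)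
    have : CompleteSpace E := FiniteDimensional.complete ℝ E
    ext1 v
    have hX := FiberBundle.mdifferentiableAt_extend I E v
    refine leviCivita_ext fun W hW => ?_
    have e1 := inner_leviCivita hX (hf.smul_section hY) hW
    have e2 := inner_leviCivita hX hY hW
    simp only [FiberBundle.extend_apply_self] at e1 e2
    have h1 := mvfderiv_fun_mul hf (mdiff_inner hY hW)
    have h2 := mvfderiv_fun_mul hf (mdiff_inner hX hY)
    simp only [add_apply, inner_add_left, smul_apply,
      ContinuousLinearMap.smulRight_apply, inner_smul_left]
    rw [e2]
    refine e1.trans ?_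
    simp [koszulForm, VectorField.mlieBracket_smul_left hf hY,
      VectorField.mlieBracket_smul_right hf hY, h1, h2, inner_add_left, inner_smul_left,
      inner_smul_right, real_inner_comm v (Y x)]
    ring

theorem leviCivita_torsionFree (hX : MDiffAt (T% X) x) (hY : MDiffAt (T% Y) x) :
    leviCivita I Y x (X x) - leviCivita I X x (Y x) = VectorField.mlieBracket I X Y x := by
  refine leviCivita_ext fun W hW => ?_
  rw [inner_sub_left, inner_leviCivita hX hY hW, inner_leviCivita hY hX hW]
  have : VectorField.mlieBracket I Y X x = - VectorField.mlieBracket I X Y x := by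
    rw [VectorField.mlieBracket_swap]; rfl
  simp only [koszulForm, this, inner_neg_left, real_inner_comm (X _) (Y _)]
  ring

theorem leviCivita_metric (hX : MDiffAt (T% X) x) (hY : MDiffAt (T% Y) x)
    (hZ : MDiffAt (T% Z) x) :
    mvfderiv I (fun y => inner ℝ (Y y) (Z y)) x (X x) =
      inner ℝ (leviCivita I Y x (X x)) (Z x) + inner ℝ (Y x) (leviCivita I Z x (X x)) := by
  rw [real_inner_comm _ (Y x), inner_leviCivita hX hY hZ, inner_leviCivita hX hZ hY]
  have : VectorField.mlieBracket I Z Y x = - VectorField.mlieBracket I Y Z x := by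
    rw [VectorField.mlieBracket_swap]; rfl
  simp only [koszulForm, this, inner_neg_left, real_inner_comm (Y _) (Z _)]
  ring
end

/-! ### Submanifolds and slant distributions -/

/-- The angle between a nonzero vector `w` and a subspace `S`: the angle, in `[0, π/2]`, between
`w` and its orthogonal projection on `S` (`π/2` if this projection vanishes). -/
noncomputable def subspaceAngle {V : Type*} [NormedAddCommGroup V] [InnerProductSpace ℝ V]
    (w : V) (S : Submodule ℝ V) [S.HasOrthogonalProjection] : ℝ :=
  InnerProductGeometry.angle w (S.starProjection w)

section

variable {n m : ℕ}
  {M : Type*} [TopologicalSpace M] [ChartedSpace (EuclideanSpace ℝ (Fin n)) M]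
  [IsManifold (𝓡 n) ∞ M]
  [RiemannianBundle (fun x : M => TangentSpace (𝓡 n) x)]
  [IsContMDiffRiemannianBundle (𝓡 n) ∞ (EuclideanSpace ℝ (Fin n))
    (fun x : M => TangentSpace (𝓡 n) x)]
  {N : Type*} [TopologicalSpace N] [ChartedSpace (EuclideanSpace ℝ (Fin m)) N]
  [IsManifold (𝓡 m) ∞ N]
  [RiemannianBundle (fun y : N => TangentSpace (𝓡 m) y)]
  [IsContMDiffRiemannianBundle (𝓡 m) ∞ (EuclideanSpace ℝ (Fin m))
    (fun y : N => TangentSpace (𝓡 m) y)]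

/-- A vector field on `M` is smooth on `U`. -/
def SmoothFieldOn (U : Set M) (X : ∀ x : M, TangentSpace (𝓡 n) x) : Prop :=
  ContMDiffOn (𝓡 n) (𝓡 n).tangent ∞ (fun x => (⟨x, X x⟩ : TangentBundle (𝓡 n) M)) U

/-- A smooth vector field on `M`, i.e. an element of `TM`. -/
def SmoothField (X : ∀ x : M, TangentSpace (𝓡 n) x) : Prop :=
  ContMDiff (𝓡 n) (𝓡 n).tangent ∞ (fun x => (⟨x, X x⟩ : TangentBundle (𝓡 n) M))

/-- `M` is an immersed submanifold of `N` through `ι`, and carries the induced metric. The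
injectivity of the differentials of `ι` follows from the preservation of inner products. -/
structure IsIsometricImmersion (ι : M → N) : Prop where
  contMDiff : ContMDiff (𝓡 n) (𝓡 m) ∞ ι
  inner_mfderiv : ∀ (x : M) (u v : TangentSpace (𝓡 n) x),
    inner ℝ (mfderiv (𝓡 n) (𝓡 m) ι x u) (mfderiv (𝓡 n) (𝓡 m) ι x v) = inner ℝ u v

/-- A smooth `(1,1)`-tensor field on `N`. -/
def SmoothEndo (φ : ∀ y : N, TangentSpace (𝓡 m) y →L[ℝ] TangentSpace (𝓡 m) y) : Prop :=
  ContMDiff (𝓡 m)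
    ((𝓡 m).prod 𝓘(ℝ, EuclideanSpace ℝ (Fin m) →L[ℝ] EuclideanSpace ℝ (Fin m))) ∞
    (fun y => TotalSpace.mk' (EuclideanSpace ℝ (Fin m) →L[ℝ] EuclideanSpace ℝ (Fin m))
      (E := fun y : N => TangentSpace (𝓡 m) y →L[ℝ] TangentSpace (𝓡 m) y) y (φ y))

/-- `(N, φ, g)` is almost Hermitian (`ε = -1`) or almost product Riemannian (`ε = 1`). -/
structure IsAlmostEpsHermitian (ε : ℝ)
    (φ : ∀ y : N, TangentSpace (𝓡 m) y →L[ℝ] TangentSpace (𝓡 m) y) : Prop where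
  smooth : SmoothEndo φ
  compat : ∀ (y : N) (u v : TangentSpace (𝓡 m) y), inner ℝ (φ y u) v = ε * inner ℝ u (φ y v)
  sq : ∀ (y : N) (v : TangentSpace (𝓡 m) y), φ y (φ y v) = ε • v

/-- `(N, φ, ξ, η, g)`, with `η` the dual `1`-form of `ξ`, is almost contact metric (`ε = -1`) or
almost paracontact metric (`ε = 1`). -/
structure IsAlmostEpsContact (ε : ℝ)
    (φ : ∀ y : N, TangentSpace (𝓡 m) y →L[ℝ] TangentSpace (𝓡 m) y)
    (ξ : ∀ y : N, TangentSpace (𝓡 m) y) : Prop where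
  smooth : SmoothEndo φ
  smooth_field : SmoothField ξ
  unit : ∀ y : N, inner ℝ (ξ y) (ξ y) = (1 : ℝ)
  compat : ∀ (y : N) (u v : TangentSpace (𝓡 m) y), inner ℝ (φ y u) v = ε * inner ℝ u (φ y v)
  sq : ∀ (y : N) (v : TangentSpace (𝓡 m) y),
    φ y (φ y v) = ε • (v - (inner ℝ v (ξ y) : ℝ) • ξ y)

/-- On the open subset `U` of `M`, the family `D` of subspaces of the tangent spaces is a smooth
regular distribution: it is locally spanned by smooth linearly independent vector fields, whose
number does not depend on the point. -/
def IsRegularDistributionOn (U : Set M) (D : ∀ x : M, Submodule ℝ (TangentSpace (𝓡 n) x)) : Prop :=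
  ∃ r : ℕ, ∀ x ∈ U, ∃ V : Set M, IsOpen V ∧ x ∈ V ∧ V ⊆ U ∧
    ∃ Y : Fin r → ∀ x : M, TangentSpace (𝓡 n) x,
      (∀ i, SmoothFieldOn V (Y i)) ∧
      ∀ y ∈ V, LinearIndependent ℝ (fun i => Y i y) ∧
        Submodule.span ℝ (Set.range fun i => Y i y) = D y

/-- The tangential part `T_{ι x} N → T_x M`: as the differential of `ι` at `x` is isometric, its
adjoint is the orthogonal projection on its image, identified with `T_x M`. -/
noncomputable def tangentialPart (ι : M → N) (x : M) :
    TangentSpace (𝓡 m) (ι x) →L[ℝ] TangentSpace (𝓡 n) x :=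
  ContinuousLinearMap.adjoint (mfderiv (𝓡 n) (𝓡 m) ι x)

/-- The localization in `x` of a distribution on `M`, as a subspace of `T_{ι x} N`. -/
noncomputable def ambientFiber (ι : M → N) (D : ∀ x : M, Submodule ℝ (TangentSpace (𝓡 n) x))
    (x : M) : Submodule ℝ (TangentSpace (𝓡 m) (ι x)) :=
  (D x).map (mfderiv (𝓡 n) (𝓡 m) ι x : TangentSpace (𝓡 n) x →ₗ[ℝ] TangentSpace (𝓡 m) (ι x))

/-- `φ v` for `v` a tangent vector of `M`, a tangent vector of `N`. -/
noncomputable def phiTangent (ι : M → N)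
    (φ : ∀ y : N, TangentSpace (𝓡 m) y →L[ℝ] TangentSpace (𝓡 m) y) (x : M) :
    TangentSpace (𝓡 n) x →L[ℝ] TangentSpace (𝓡 m) (ι x) :=
  (φ (ι x)).comp (mfderiv (𝓡 n) (𝓡 m) ι x)

/-- The component `f` of `φ` into the distribution `D` on `M`, on tangent vectors of `M`: `f v` is
the orthogonal projection of `φ v` on `D`. -/
noncomputable def component (ι : M → N)
    (φ : ∀ y : N, TangentSpace (𝓡 m) y →L[ℝ] TangentSpace (𝓡 m) y)
    (D : ∀ x : M, Submodule ℝ (TangentSpace (𝓡 n) x)) (x : M) :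
    TangentSpace (𝓡 n) x →L[ℝ] TangentSpace (𝓡 n) x :=
  ((D x).starProjection.comp (tangentialPart ι x)).comp (phiTangent ι φ x)

/-- On the open subset `U`, `D` is a pointwise slant distribution with slant function `θ`. -/
structure IsPointwiseSlantOn (U : Set M) (ι : M → N)
    (φ : ∀ y : N, TangentSpace (𝓡 m) y →L[ℝ] TangentSpace (𝓡 m) y)
    (D : ∀ x : M, Submodule ℝ (TangentSpace (𝓡 n) x)) (θ : M → ℝ) : Prop where
  nonnull : ∃ x ∈ U, D x ≠ ⊥
  continuousOn : ContinuousOn θ U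
  range : ∀ x ∈ U, θ x ∈ Set.Ioc 0 (Real.pi / 2)
  slant : ∀ x ∈ U, ∀ v ∈ D x, v ≠ 0 → phiTangent ι φ x v ≠ 0 ∧
    subspaceAngle (phiTangent ι φ x v) (ambientFiber ι D x) = θ x

/-- On the open subset `U`, `D` is a slant distribution with (constant) slant angle `θ`. -/
def IsSlantOn (U : Set M) (ι : M → N)
    (φ : ∀ y : N, TangentSpace (𝓡 m) y →L[ℝ] TangentSpace (𝓡 m) y)
    (D : ∀ x : M, Submodule ℝ (TangentSpace (𝓡 n) x)) (θ : ℝ) : Prop :=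
  IsPointwiseSlantOn U ι φ D (fun _ => θ)

/-- On the open subset `U`, `D` is an invariant distribution: `φ v ∈ D` for `v ∈ D`. -/
def IsInvariantOn (U : Set M) (ι : M → N)
    (φ : ∀ y : N, TangentSpace (𝓡 m) y →L[ℝ] TangentSpace (𝓡 m) y)
    (D : ∀ x : M, Submodule ℝ (TangentSpace (𝓡 n) x)) : Prop :=
  ∀ x ∈ U, ∀ v ∈ D x, phiTangent ι φ x v ∈ ambientFiber ι D x

/-- The sum `D₀ ⊕ D₁ ⊕ ⋯ ⊕ D_k`. -/
noncomputable def totalDistribution {k : ℕ} (D : Fin (k + 1) → ∀ x : M, Submodule ℝ (TangentSpace (𝓡 n) x))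
    (x : M) : Submodule ℝ (TangentSpace (𝓡 n) x) :=
  ⨆ i, D i x

/-- The sum `D₁ ⊕ ⋯ ⊕ D_k`. -/
noncomputable def properDistribution {k : ℕ} (D : Fin (k + 1) → ∀ x : M, Submodule ℝ (TangentSpace (𝓡 n) x))
    (x : M) : Submodule ℝ (TangentSpace (𝓡 n) x) :=
  ⨆ i : Fin k, D i.succ x

/-- On the open subset `U`, `D₀ ⊕ ⋯ ⊕ D_k` is a `k`-pointwise slant distribution, with invariant
component `D₀` (possibly null) and slant functions `θ₁, …, θ_k`, which are distinct as functions. -/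
structure IsKPointwiseSlantDistributionOn (U : Set M) (ι : M → N)
    (φ : ∀ y : N, TangentSpace (𝓡 m) y →L[ℝ] TangentSpace (𝓡 m) y) {k : ℕ}
    (D : Fin (k + 1) → ∀ x : M, Submodule ℝ (TangentSpace (𝓡 n) x)) (θ : Fin k → M → ℝ) :
    Prop where
  regular : ∀ i, IsRegularDistributionOn U (D i)
  orthogonal : ∀ x ∈ U, ∀ i j, i ≠ j → D i x ⟂ D j x
  distinct : ∀ i j, i ≠ j → ∃ x ∈ U, θ i x ≠ θ j x
  slant : ∀ i : Fin k, IsPointwiseSlantOn U ι φ (D i.succ) (θ i)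
  invariant : IsInvariantOn U ι φ (D 0)
  component_mem : ∀ i : Fin k, ∀ x ∈ U, ∀ v ∈ D i.succ x,
    component ι φ (totalDistribution D) x v ∈ D i.succ x

/-- On the open subset `U`, `D₀ ⊕ ⋯ ⊕ D_k` is a `k`-slant distribution, with invariant component
`D₀` (possibly null) and distinct slant angles `θ₁, …, θ_k`. -/
structure IsKSlantDistributionOn (U : Set M) (ι : M → N)
    (φ : ∀ y : N, TangentSpace (𝓡 m) y →L[ℝ] TangentSpace (𝓡 m) y) {k : ℕ}
    (D : Fin (k + 1) → ∀ x : M, Submodule ℝ (TangentSpace (𝓡 n) x)) (θ : Fin k → ℝ) :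
    Prop where
  regular : ∀ i, IsRegularDistributionOn U (D i)
  orthogonal : ∀ x ∈ U, ∀ i j, i ≠ j → D i x ⟂ D j x
  distinct : Function.Injective θ
  slant : ∀ i : Fin k, IsSlantOn U ι φ (D i.succ) (θ i)
  invariant : IsInvariantOn U ι φ (D 0)
  component_mem : ∀ i : Fin k, ∀ x ∈ U, ∀ v ∈ D i.succ x,
    component ι φ (totalDistribution D) x v ∈ D i.succ x

/-- On `U`, the tangent bundle of `M` is the orthogonal sum `D₀ ⊕ ⋯ ⊕ D_k ⊕ ⟨ξ⟩`, for `ξ` tangent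
to `M`. For `ξ = 0` this says that it is the sum `D₀ ⊕ ⋯ ⊕ D_k`. -/
def IsTangentDecompositionOn (U : Set M) (ι : M → N) (ξ : ∀ y : N, TangentSpace (𝓡 m) y) {k : ℕ}
    (D : Fin (k + 1) → ∀ x : M, Submodule ℝ (TangentSpace (𝓡 n) x)) : Prop :=
  ∀ x ∈ U, (∀ i, D i x ⟂ Submodule.span ℝ {tangentialPart ι x (ξ (ι x))}) ∧
    totalDistribution D x ⊔ Submodule.span ℝ {tangentialPart ι x (ξ (ι x))} = ⊤

/-- `M` is a `k`-pointwise slant submanifold of `N`, by means of the decomposition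
`TM = D₀ ⊕ ⋯ ⊕ D_k` (if `ξ = 0`) or `TM = D₀ ⊕ ⋯ ⊕ D_k ⊕ ⟨ξ⟩` and the slant functions `θ`. -/
def IsKPointwiseSlantSubmanifold (ι : M → N)
    (φ : ∀ y : N, TangentSpace (𝓡 m) y →L[ℝ] TangentSpace (𝓡 m) y)
    (ξ : ∀ y : N, TangentSpace (𝓡 m) y) {k : ℕ}
    (D : Fin (k + 1) → ∀ x : M, Submodule ℝ (TangentSpace (𝓡 n) x)) (θ : Fin k → M → ℝ) : Prop :=
  IsKPointwiseSlantDistributionOn Set.univ ι φ D θ ∧ IsTangentDecompositionOn Set.univ ι ξ D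

/-- The open subset `U` of `M` is a `k`-slant submanifold of `N`. -/
def IsKSlantSubmanifoldOn (U : Set M) (ι : M → N)
    (φ : ∀ y : N, TangentSpace (𝓡 m) y →L[ℝ] TangentSpace (𝓡 m) y)
    (ξ : ∀ y : N, TangentSpace (𝓡 m) y) (k : ℕ) : Prop :=
  ∃ (D : Fin (k + 1) → ∀ x : M, Submodule ℝ (TangentSpace (𝓡 n) x)) (θ : Fin k → ℝ),
    IsKSlantDistributionOn U ι φ D θ ∧ IsTangentDecompositionOn U ι ξ D

/-- `λ_i = ε cos² θ_i`, the eigenvalue of `f²` on `D_i`. -/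
noncomputable def slantEigenvalue (ε : ℝ) {k : ℕ} (θ : Fin k → M → ℝ) (i : Fin k) (x : M) : ℝ :=
  ε * Real.cos (θ i x) ^ 2

/-- `(∇_X f²) Y = ∇_X (f² Y) - f² (∇_X Y)` for `f` a field of endomorphisms of the tangent spaces
of `M` and `∇` the Levi-Civita connection of `M`. -/
noncomputable def covDerivSq (f : ∀ x : M, TangentSpace (𝓡 n) x →L[ℝ] TangentSpace (𝓡 n) x)
    (X Y : ∀ x : M, TangentSpace (𝓡 n) x) (x : M) : TangentSpace (𝓡 n) x :=
  leviCivita (𝓡 n) (fun y => f y (f y (Y y))) x (X x) -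
    f x (f x (leviCivita (𝓡 n) Y x (X x)))

/-- `(∇_X f²) Y = 0` for all `X ∈ TM` and `Y ∈ D₁ ⊕ ⋯ ⊕ D_k`, with `f` the component of `φ` into
`D₀ ⊕ ⋯ ⊕ D_k`. -/
def IsSqParallel (ι : M → N)
    (φ : ∀ y : N, TangentSpace (𝓡 m) y →L[ℝ] TangentSpace (𝓡 m) y) {k : ℕ}
    (D : Fin (k + 1) → ∀ x : M, Submodule ℝ (TangentSpace (𝓡 n) x)) : Prop :=
  ∀ X Y : ∀ x : M, TangentSpace (𝓡 n) x, SmoothField X → SmoothField Y →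
    (∀ x, Y x ∈ properDistribution D x) →
    ∀ x, covDerivSq (component ι φ (totalDistribution D)) X Y x = 0

/-- `f² (∇_X Y) = λ_i ∇_X Y` for all `X ∈ TM` and `Y ∈ D_i`, `i = 1, …, k`, with `f` the component
of `φ` into `D₀ ⊕ ⋯ ⊕ D_k`. -/
def IsCovDerivEigen (ι : M → N) (ε : ℝ)
    (φ : ∀ y : N, TangentSpace (𝓡 m) y →L[ℝ] TangentSpace (𝓡 m) y) {k : ℕ}
    (D : Fin (k + 1) → ∀ x : M, Submodule ℝ (TangentSpace (𝓡 n) x)) (θ : Fin k → M → ℝ) : Prop :=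
  ∀ (i : Fin k) (X Y : ∀ x : M, TangentSpace (𝓡 n) x), SmoothField X → SmoothField Y →
    (∀ x, Y x ∈ D i.succ x) →
    ∀ x, component ι φ (totalDistribution D) x
        (component ι φ (totalDistribution D) x (leviCivita (𝓡 n) Y x (X x))) =
      slantEigenvalue ε θ i x • leviCivita (𝓡 n) Y x (X x)

end

set_option linter.unusedSectionVars false

/-! ### Linear algebra of slant subspaces -/

section

variable {V : Type*} [NormedAddCommGroup V] [InnerProductSpace ℝ V]

/-! Let `T` be the tangential part of `φ`. It is `ε`-symmetric, so `T²` is symmetric; it kills the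
tangential field `ξ` and takes values orthogonal to it, so projecting further on `D₀ ⊕ ⋯ ⊕ D_k`, the
orthogonal complement of `ξ`, changes nothing and `f = T` (`component_eq`). On an invariant subspace
orthogonal to `ξ`, a slant angle `θ` means `‖T v‖ = cos θ ‖v‖`, and by polarization this is `T² = ε
cos² θ`. Everything thus becomes a statement about the eigenspaces of a field of symmetric
operators.

For `Y ∈ D_i` the Leibniz rule gives `(∇_X f²) Y = λ_i ∇_X Y + X(λ_i) Y - f² ∇_X Y`
(`covDerivSq_eq`). Pairing with `Y` and using the symmetry of `f²` cancels the first and last terms,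
so 1) forces `X(λ_i) = 0`: the eigenvalues are locally constant, and what remains is 2) i).
Conversely, if they are locally constant, 2) i) makes the expression vanish on each `D_i`, hence on
their sum (`isSqParallel_of_isLocallyConstant`).

It remains to compare constancy of the `λ_i` with slantness. If they are constant on a component,
merging the `D_i` of equal eigenvalue gives a slant decomposition. Conversely, any slant
decomposition, possibly unrelated to the given one, diagonalizes the same `T²` with finitely many
constant eigenvalues; each continuous `λ_i` takes values in this finite set, hence is constant on a
connected set (`slantEigenvalue_eq_of_isKSlantSubmanifoldOn`). The `θ_i` are distinct only as
functions on all of `M`, so two of them may agree on a component, and `k'` may drop there; on a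
connected `M` they cannot, and `k' = k`. -/

/-- An `ε`-symmetric operator which scales the norm of an invariant subspace by `c` has square
`ε c²` on this subspace. -/
lemma apply_apply_eq_smul_of_norm_eq {ε c : ℝ} {T : V →L[ℝ] V}
    (hT : ∀ u v, inner ℝ (T u) v = ε * inner ℝ u (T v)) {S : Submodule ℝ V}
    (hS : ∀ v ∈ S, T v ∈ S) (hc : ∀ v ∈ S, ‖T v‖ = c * ‖v‖) {v : V} (hv : v ∈ S) :
    T (T v) = (ε * c ^ 2) • v := by
  -- Polarization: the scaling also holds for `u + w`, as `S` is a subspace.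
  have inner_T : ∀ u ∈ S, ∀ w ∈ S, inner ℝ (T u) (T w) = c ^ 2 * inner ℝ u w := by
    intro u hu w hw
    rw [real_inner_eq_norm_add_mul_self_sub_norm_mul_self_sub_norm_mul_self_div_two, ← map_add,
      hc u hu, hc w hw, hc _ (S.add_mem hu hw),
      real_inner_eq_norm_add_mul_self_sub_norm_mul_self_sub_norm_mul_self_div_two]
    ring
  have key : ∀ u ∈ S, inner ℝ (T (T v) - (ε * c ^ 2) • v) u = 0 := by
    intro u hu
    rw [inner_sub_left, hT, inner_T v hv u hu, real_inner_smul_left]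
    ring
  have hmem : T (T v) - (ε * c ^ 2) • v ∈ S :=
    S.sub_mem (hS _ (hS _ hv)) (S.smul_mem _ hv)
  exact sub_eq_zero.mp (inner_self_eq_zero.mp (key _ hmem))

/-- This is the converse of the previous lemma: `‖T v‖² = ⟪T v, T v⟫ = ε ⟪v, T² v⟫ = c² ‖v‖²`. -/
lemma norm_eq_of_apply_apply_eq_smul {ε c : ℝ} (hε : ε * ε = 1) (hc : 0 ≤ c) {T : V →L[ℝ] V}
    (hT : ∀ u v, inner ℝ (T u) v = ε * inner ℝ u (T v)) {v : V}
    (hv : T (T v) = (ε * c ^ 2) • v) : ‖T v‖ = c * ‖v‖ := by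
  have h : ‖T v‖ ^ 2 = (c * ‖v‖) ^ 2 := by
    rw [← real_inner_self_eq_norm_sq, hT, hv, real_inner_smul_right,
      real_inner_self_eq_norm_sq]
    linear_combination (c ^ 2 * ‖v‖ ^ 2) * hε
  exact (sq_eq_sq₀ (norm_nonneg _) (by positivity)).mp h

/-- Moving `T` across twice costs `ε² = 1`, so `T²` is symmetric for both signs. -/
lemma inner_apply_apply_comm {ε : ℝ} {T : V →L[ℝ] V}
    (hT : ∀ u v, inner ℝ (T u) v = ε * inner ℝ u (T v)) (hε : ε * ε = 1) (u v : V) :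
    inner ℝ (T (T u)) v = inner ℝ u (T (T v)) := by
  rw [hT, hT, ← mul_assoc, hε, one_mul]

/-- An eigenvalue of a symmetric operator on the sum of a family of eigenspaces is one of the
corresponding eigenvalues. -/
lemma exists_eigenvalue_eq_of_mem_iSup {ι : Type*} {A : V → V}
    (hA : ∀ u v, inner ℝ (A u) v = inner ℝ u (A v)) {S : ι → Submodule ℝ V} {μ : ι → ℝ}
    (hS : ∀ i, ∀ u ∈ S i, A u = μ i • u) {v : V} (hv : v ∈ ⨆ i, S i) (hv0 : v ≠ 0) {c : ℝ}
    (hc : A v = c • v) : ∃ i, μ i = c := by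
  -- Otherwise `v` would be orthogonal to the whole sum, hence to itself.
  have : ∃ i, ∃ u ∈ S i, inner ℝ v u ≠ 0 := by
    by_contra! h
    have hle : (⨆ i, S i) ≤ (ℝ ∙ v)ᗮ :=
      iSup_le fun i u hu => Submodule.mem_orthogonal_singleton_iff_inner_right.mpr (h i u hu)
    exact hv0 (inner_self_eq_zero.mp
      (Submodule.mem_orthogonal_singleton_iff_inner_right.mp (hle hv)))
  obtain ⟨i, u, hu, hne⟩ := this
  refine ⟨i, mul_right_cancel₀ hne ?_⟩
  have := hA v u
  rw [hc, hS i u hu, real_inner_smul_left, real_inner_smul_right] at this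
  exact this.symm

lemma span_range_gramSchmidtNormed {r : ℕ} (e : Fin r → V) :
    Submodule.span ℝ (Set.range (InnerProductSpace.gramSchmidtNormed ℝ e)) =
      Submodule.span ℝ (Set.range e) :=
  (InnerProductSpace.span_gramSchmidtNormed_range e).trans (InnerProductSpace.span_gramSchmidt ℝ e)

lemma starProjection_span_range_of_orthonormal [FiniteDimensional ℝ V] {ι : Type*} [Fintype ι]
    {e : ι → V} (he : Orthonormal ℝ e) {S : Submodule ℝ V}
    (hS : Submodule.span ℝ (Set.range e) = S) (v : V) :
    S.starProjection v = ∑ i, inner ℝ (e i) v • e i := by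
  classical
  subst hS
  apply Submodule.eq_starProjection_of_mem_of_inner_eq_zero
  · exact Submodule.sum_mem _ fun i _ =>
      Submodule.smul_mem _ _ (Submodule.subset_span (Set.mem_range_self i))
  · intro w hw
    induction hw using Submodule.span_induction with
    | mem w hw =>
      obtain ⟨i, rfl⟩ := hw
      rw [inner_sub_left, sub_eq_zero, real_inner_comm, sum_inner]
      simp [real_inner_smul_left, orthonormal_iff_ite.mp he]
    | zero => simp
    | add a b _ _ ha hb => rw [inner_add_right, ha, hb, add_zero]
    | smul c a _ ha => rw [real_inner_smul_right, ha, mul_zero]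

end


/-! ### Structures `φ` along an isometric linear embedding -/

section

variable {V W : Type*} [NormedAddCommGroup V] [InnerProductSpace ℝ V] [CompleteSpace V]
  [NormedAddCommGroup W] [InnerProductSpace ℝ W] [CompleteSpace W]

/-- The algebraic properties of `φ` at a point of the submanifold: `L` is the differential of the
immersion, `ψ` is `φ` and `ζ` is the structure vector (or zero). -/
structure IsEpsStructureAt (ε : ℝ) (L : V →L[ℝ] W) (ψ : W →L[ℝ] W) (ζ : V) : Prop where
  inner_map : ∀ u v, inner ℝ (L u) (L v) = (inner ℝ u v : ℝ)
  eps : ε * ε = 1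
  compat : ∀ u v, inner ℝ (ψ u) v = ε * inner ℝ u (ψ v)
  sq : ∀ v, ψ (ψ v) = ε • (v - (inner ℝ v (L ζ) : ℝ) • L ζ)
  apply_field : ψ (L ζ) = 0

/-- The compression of `ψ` along `L`. -/
noncomputable def compression (L : V →L[ℝ] W) (ψ : W →L[ℝ] W) : V →L[ℝ] V :=
  L.adjoint.comp (ψ.comp L)

variable {ε : ℝ} {L : V →L[ℝ] W} {ψ : W →L[ℝ] W} {ζ : V}

lemma inner_compression_left (u v : V) :
    inner ℝ (compression L ψ u) v = (inner ℝ (ψ (L u)) (L v) : ℝ) := by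
  rw [compression, ContinuousLinearMap.comp_apply, ContinuousLinearMap.adjoint_inner_left,
    ContinuousLinearMap.comp_apply]

namespace IsEpsStructureAt

lemma adjoint_apply (h : IsEpsStructureAt ε L ψ ζ) (v : V) : L.adjoint (L v) = v :=
  ext_inner_right ℝ fun w => by rw [ContinuousLinearMap.adjoint_inner_left, h.inner_map]

lemma norm_map (h : IsEpsStructureAt ε L ψ ζ) (v : V) : ‖L v‖ = ‖v‖ := by
  rw [norm_eq_sqrt_real_inner, norm_eq_sqrt_real_inner, h.inner_map]

lemma inner_compression (h : IsEpsStructureAt ε L ψ ζ) (u v : V) :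
    inner ℝ (compression L ψ u) v = ε * inner ℝ u (compression L ψ v) := by
  rw [real_inner_comm _ u, inner_compression_left, inner_compression_left, h.compat,
    real_inner_comm]

lemma compression_field (h : IsEpsStructureAt ε L ψ ζ) : compression L ψ ζ = 0 := by
  simp [compression, h.apply_field]

lemma inner_compression_field (h : IsEpsStructureAt ε L ψ ζ) (v : V) :
    inner ℝ (compression L ψ v) ζ = (0 : ℝ) := by
  rw [h.inner_compression, h.compression_field, inner_zero_right, mul_zero]

lemma sq_map (h : IsEpsStructureAt ε L ψ ζ) {v : V} (hv : inner ℝ v ζ = (0 : ℝ)) :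
    ψ (ψ (L v)) = ε • L v := by
  rw [h.sq, h.inner_map, hv, zero_smul, sub_zero]

/-- Off the structure vector `φ` is an isometry, since `‖φ v‖² = ε ⟪v, φ² v⟫`. This makes `‖T v‖ /
‖v‖` the cosine of the slant angle. -/
lemma norm_apply (h : IsEpsStructureAt ε L ψ ζ) {v : V} (hv : inner ℝ v ζ = (0 : ℝ)) :
    ‖ψ (L v)‖ = ‖v‖ := by
  have e : ‖ψ (L v)‖ ^ 2 = ‖v‖ ^ 2 := by
    rw [← real_inner_self_eq_norm_sq, h.compat, h.sq_map hv, real_inner_smul_right,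
      h.inner_map, real_inner_self_eq_norm_sq, ← mul_assoc, h.eps, one_mul]
  exact (sq_eq_sq₀ (norm_nonneg _) (norm_nonneg _)).mp e

/-- For `v ∈ S` orthogonal to `ζ` and `S` invariant, the slant condition only involves the norm of
the tangential part of `ψ v`. -/
lemma subspaceAngle_eq_iff (h : IsEpsStructureAt ε L ψ ζ) {S : Submodule ℝ V}
    [(S.map (L : V →ₗ[ℝ] W)).HasOrthogonalProjection]
    (hS : ∀ v ∈ S, compression L ψ v ∈ S) {v : V} (hvS : v ∈ S)
    (hv : inner ℝ v ζ = (0 : ℝ)) (hv0 : v ≠ 0) {θ : ℝ} (hθ : θ ∈ Set.Ioc 0 (Real.pi / 2)) :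
    (ψ (L v) ≠ 0 ∧ subspaceAngle (ψ (L v)) (S.map (L : V →ₗ[ℝ] W)) = θ) ↔
      ‖compression L ψ v‖ = Real.cos θ * ‖v‖ := by
  have hn : 0 < ‖v‖ := norm_pos_iff.mpr hv0
  have hne : ψ (L v) ≠ 0 := by
    rw [← norm_pos_iff, h.norm_apply hv]; exact hn
  -- As `S` is invariant under the compression, projecting on the image of `S` is the same as
  -- projecting on the whole image of `L`.
  have hproj : (S.map (L : V →ₗ[ℝ] W)).starProjection (ψ (L v)) = L (compression L ψ v) := by
    apply Submodule.eq_starProjection_of_mem_of_inner_eq_zero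
    · exact Submodule.mem_map_of_mem (hS v hvS)
    · rintro _ ⟨u, -, rfl⟩
      rw [inner_sub_left, sub_eq_zero]
      exact (inner_compression_left v u).symm.trans (h.inner_map _ _).symm
  have hcos : Real.cos (subspaceAngle (ψ (L v)) (S.map (L : V →ₗ[ℝ] W))) =
      ‖compression L ψ v‖ / ‖v‖ := by
    rw [subspaceAngle, hproj, InnerProductGeometry.cos_angle, h.norm_map, h.norm_apply hv,
      ← inner_compression_left, real_inner_self_eq_norm_mul_norm]
    -- If the projection vanishes, the angle is `π/2` by convention, in agreement with cosine `0`.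
    rcases eq_or_ne ‖compression L ψ v‖ 0 with h0 | h0
    · simp [h0]
    · field_simp
  rw [← div_eq_iff hn.ne', ← hcos]
  constructor
  · rintro ⟨-, rfl⟩; rfl
  · intro hc
    exact ⟨hne, Real.injOn_cos ⟨InnerProductGeometry.angle_nonneg _ _,
      InnerProductGeometry.angle_le_pi _ _⟩ ⟨hθ.1.le, by linarith [hθ.2, Real.pi_pos]⟩ hc⟩

/-- A subspace orthogonal to `ζ` which spans everything together with `ζ` is its full orthogonal
complement (everything if `ζ = 0`). Consequently all decompositions have the same total
distribution. -/
lemma mem_iff_inner_field {S : Submodule ℝ V} (hS : S ⟂ ℝ ∙ ζ) (htop : S ⊔ ℝ ∙ ζ = ⊤) {v : V} :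
    v ∈ S ↔ inner ℝ v ζ = (0 : ℝ) := by
  constructor
  · exact fun hv => Submodule.mem_orthogonal_singleton_iff_inner_left.mp (hS hv)
  · intro hv
    obtain ⟨a, ha, b, hb, rfl⟩ := Submodule.mem_sup.mp (htop ▸ Submodule.mem_top : v ∈ S ⊔ ℝ ∙ ζ)
    have hb' : b ∈ (ℝ ∙ ζ)ᗮ := by
      have := Submodule.sub_mem _ (Submodule.mem_orthogonal_singleton_iff_inner_left.mpr hv) (hS ha)
      simpa using this
    have : b = 0 := inner_self_eq_zero.mp (hb' b hb)
    simpa [this] using ha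

lemma starProjection_compression (h : IsEpsStructureAt ε L ψ ζ) {S : Submodule ℝ V}
    [S.HasOrthogonalProjection] (hS : S ⟂ ℝ ∙ ζ) (htop : S ⊔ ℝ ∙ ζ = ⊤) (v : V) :
    S.starProjection (compression L ψ v) = compression L ψ v :=
  Submodule.starProjection_eq_self_iff.mpr
    ((mem_iff_inner_field hS htop).mpr (h.inner_compression_field v))

/-- When `φ v` is tangent, the compression loses nothing and its square on `v` is that of `φ`. -/
lemma sq_compression_of_invariant (h : IsEpsStructureAt ε L ψ ζ) {u v : V}
    (hv : inner ℝ v ζ = (0 : ℝ)) (huv : L u = ψ (L v)) :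
    compression L ψ (compression L ψ v) = ε • v := by
  have h2 : compression L ψ v = u := by
    rw [compression, ContinuousLinearMap.comp_apply, ContinuousLinearMap.comp_apply, ← huv,
      h.adjoint_apply]
  rw [h2, compression, ContinuousLinearMap.comp_apply, ContinuousLinearMap.comp_apply, huv,
    h.sq_map hv, map_smul, h.adjoint_apply]

lemma sq_compression_of_subspaceAngle (h : IsEpsStructureAt ε L ψ ζ) {S : Submodule ℝ V}
    [(S.map (L : V →ₗ[ℝ] W)).HasOrthogonalProjection] (hSζ : ∀ v ∈ S, inner ℝ v ζ = (0 : ℝ))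
    (hS : ∀ v ∈ S, compression L ψ v ∈ S) {θ : ℝ} (hθ : θ ∈ Set.Ioc 0 (Real.pi / 2))
    (hs : ∀ v ∈ S, v ≠ 0 → ψ (L v) ≠ 0 ∧
      subspaceAngle (ψ (L v)) (S.map (L : V →ₗ[ℝ] W)) = θ) {v : V} (hv : v ∈ S) :
    compression L ψ (compression L ψ v) = (ε * Real.cos θ ^ 2) • v := by
  refine apply_apply_eq_smul_of_norm_eq h.inner_compression hS (fun u hu => ?_) hv
  rcases eq_or_ne u 0 with rfl | hu0
  · simp
  · exact (h.subspaceAngle_eq_iff hS hu (hSζ u hu) hu0 hθ).mp (hs u hu hu0)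

lemma subspaceAngle_of_sq_compression (h : IsEpsStructureAt ε L ψ ζ) {S : Submodule ℝ V}
    [(S.map (L : V →ₗ[ℝ] W)).HasOrthogonalProjection] (hSζ : ∀ v ∈ S, inner ℝ v ζ = (0 : ℝ))
    (hS : ∀ v ∈ S, compression L ψ v ∈ S) {θ : ℝ} (hθ : θ ∈ Set.Ioc 0 (Real.pi / 2))
    (hsq : ∀ v ∈ S, compression L ψ (compression L ψ v) = (ε * Real.cos θ ^ 2) • v)
    {v : V} (hv : v ∈ S) (hv0 : v ≠ 0) :
    ψ (L v) ≠ 0 ∧ subspaceAngle (ψ (L v)) (S.map (L : V →ₗ[ℝ] W)) = θ :=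
  (h.subspaceAngle_eq_iff hS hv (hSζ v hv) hv0 hθ).mpr <|
    norm_eq_of_apply_apply_eq_smul h.eps
      (Real.cos_nonneg_of_neg_pi_div_two_le_of_le (by linarith [hθ.1, Real.pi_pos]) hθ.2)
      h.inner_compression (hsq v hv)

end IsEpsStructureAt

end

/-! ### The component of `φ` into a complement of the structure vector field -/

section

variable {n m : ℕ}
  {M : Type*} [TopologicalSpace M] [ChartedSpace (EuclideanSpace ℝ (Fin n)) M]
  [IsManifold (𝓡 n) ∞ M]
  [RiemannianBundle (fun x : M => TangentSpace (𝓡 n) x)]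
  [IsContMDiffRiemannianBundle (𝓡 n) ∞ (EuclideanSpace ℝ (Fin n))
    (fun x : M => TangentSpace (𝓡 n) x)]
  {N : Type*} [TopologicalSpace N] [ChartedSpace (EuclideanSpace ℝ (Fin m)) N]
  [IsManifold (𝓡 m) ∞ N]
  [RiemannianBundle (fun y : N => TangentSpace (𝓡 m) y)]
  [IsContMDiffRiemannianBundle (𝓡 m) ∞ (EuclideanSpace ℝ (Fin m))
    (fun y : N => TangentSpace (𝓡 m) y)]

/-- The tangential part `T_x M → T_x M` of `φ`. -/
noncomputable def tangentialPhi (ι : M → N)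
    (φ : ∀ y : N, TangentSpace (𝓡 m) y →L[ℝ] TangentSpace (𝓡 m) y) (x : M) :
    TangentSpace (𝓡 n) x →L[ℝ] TangentSpace (𝓡 n) x :=
  compression (mfderiv (𝓡 n) (𝓡 m) ι x) (φ (ι x))

/-- At every point of `M`, `φ` and `ξ` have the algebraic properties which both settings share. -/
def IsEpsStructureAlong (ι : M → N) (ε : ℝ)
    (φ : ∀ y : N, TangentSpace (𝓡 m) y →L[ℝ] TangentSpace (𝓡 m) y)
    (ξ : ∀ y : N, TangentSpace (𝓡 m) y) : Prop :=
  ∀ x : M, IsEpsStructureAt ε (mfderiv (𝓡 n) (𝓡 m) ι x) (φ (ι x)) (tangentialPart ι x (ξ (ι x)))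

variable {ι : M → N} {ε : ℝ} {φ : ∀ y : N, TangentSpace (𝓡 m) y →L[ℝ] TangentSpace (𝓡 m) y}
  {ξ : ∀ y : N, TangentSpace (𝓡 m) y}

lemma tangentialPart_mfderiv (hι : IsIsometricImmersion (n := n) (m := m) ι) (x : M)
    (v : TangentSpace (𝓡 n) x) :
    tangentialPart ι x (mfderiv (𝓡 n) (𝓡 m) ι x v) = v :=
  ext_inner_right ℝ fun w => by
    rw [tangentialPart, ContinuousLinearMap.adjoint_inner_left, hι.inner_mfderiv]

lemma isEpsStructureAlong (hι : IsIsometricImmersion (n := n) (m := m) ι)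
    (hε : ε = 1 ∨ ε = -1)
    (hstr : (IsAlmostEpsHermitian ε φ ∧ ∀ y, ξ y = 0) ∨
      (IsAlmostEpsContact ε φ ξ ∧ ∀ x : M, ξ (ι x) ∈ Set.range (mfderiv (𝓡 n) (𝓡 m) ι x))) :
    IsEpsStructureAlong (n := n) ι ε φ ξ := by
  have hε2 : ε * ε = 1 := by rcases hε with rfl | rfl <;> norm_num
  intro x
  rcases hstr with ⟨h, h0⟩ | ⟨h, hξ⟩
  · refine ⟨hι.inner_mfderiv x, hε2, h.compat _, fun v => ?_, ?_⟩
    · rw [h.sq, h0, map_zero, map_zero, smul_zero, sub_zero]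
    · rw [h0, map_zero, map_zero, map_zero]
  · have ht : mfderiv (𝓡 n) (𝓡 m) ι x (tangentialPart ι x (ξ (ι x))) = ξ (ι x) := by
      obtain ⟨v, hv⟩ := hξ x
      rw [← hv, tangentialPart_mfderiv hι]
    refine ⟨hι.inner_mfderiv x, hε2, h.compat _, fun v => ?_, ?_⟩
    · rw [h.sq, ht]
    -- `φ ξ = 0` follows from the axioms: `‖φ ξ‖² = ε ⟪ξ, φ² ξ⟫`, and `φ² ξ = 0` because `ξ` is a
    -- unit vector.
    · rw [ht, ← inner_self_eq_zero (𝕜 := ℝ), h.compat, h.sq, h.unit, one_smul, sub_self,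
        smul_zero, inner_zero_right, mul_zero]

namespace IsEpsStructureAlong

lemma inner_sq_tangentialPhi (h : IsEpsStructureAlong (n := n) ι ε φ ξ) (x : M)
    (u v : TangentSpace (𝓡 n) x) :
    inner ℝ (tangentialPhi ι φ x (tangentialPhi ι φ x u)) v =
      (inner ℝ u (tangentialPhi ι φ x (tangentialPhi ι φ x v)) : ℝ) :=
  inner_apply_apply_comm (h x).inner_compression (h x).eps u v

end IsEpsStructureAlong

variable {U : Set M} {k : ℕ} {D : Fin (k + 1) → ∀ x : M, Submodule ℝ (TangentSpace (𝓡 n) x)}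

lemma IsTangentDecompositionOn.isOrtho_total (hD : IsTangentDecompositionOn U ι ξ D) {x : M}
    (hx : x ∈ U) : totalDistribution D x ⟂ ℝ ∙ tangentialPart ι x (ξ (ι x)) :=
  iSup_le fun i => (hD x hx).1 i

lemma IsTangentDecompositionOn.mem_total_iff (hD : IsTangentDecompositionOn U ι ξ D) {x : M}
    (hx : x ∈ U) {v : TangentSpace (𝓡 n) x} :
    v ∈ totalDistribution D x ↔ inner ℝ v (tangentialPart ι x (ξ (ι x))) = (0 : ℝ) :=
  IsEpsStructureAt.mem_iff_inner_field (hD.isOrtho_total hx) (hD x hx).2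

lemma IsTangentDecompositionOn.inner_field (hD : IsTangentDecompositionOn U ι ξ D) {x : M}
    (hx : x ∈ U) (i : Fin (k + 1)) (v : TangentSpace (𝓡 n) x) (hv : v ∈ D i x) :
    inner ℝ v (tangentialPart ι x (ξ (ι x))) = (0 : ℝ) :=
  (hD.mem_total_iff hx).mp (Submodule.mem_iSup_of_mem i hv)

namespace IsEpsStructureAlong

/-- The right-hand side does not involve `D`: two different decompositions yield the same operator,
which is what makes them comparable. -/
lemma component_eq (h : IsEpsStructureAlong (n := n) ι ε φ ξ)
    (hD : IsTangentDecompositionOn U ι ξ D) {x : M} (hx : x ∈ U) :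
    component ι φ (totalDistribution D) x = tangentialPhi ι φ x :=
  ContinuousLinearMap.ext fun v =>
    (h x).starProjection_compression (hD.isOrtho_total hx) (hD x hx).2 v

lemma sq_tangentialPhi_of_invariant (h : IsEpsStructureAlong (n := n) ι ε φ ξ)
    (hD : IsTangentDecompositionOn U ι ξ D) (h0 : IsInvariantOn U ι φ (D 0)) {x : M}
    (hx : x ∈ U) {v : TangentSpace (𝓡 n) x} (hv : v ∈ D 0 x) :
    tangentialPhi ι φ x (tangentialPhi ι φ x v) = ε • v := by
  obtain ⟨u, -, huv⟩ := h0 x hx v hv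
  exact (h x).sq_compression_of_invariant (hD.inner_field hx 0 v hv) huv

lemma tangentialPhi_mem (h : IsEpsStructureAlong (n := n) ι ε φ ξ)
    (hD : IsTangentDecompositionOn U ι ξ D) {i : Fin (k + 1)} {x : M} (hx : x ∈ U)
    (hf : ∀ v ∈ D i x, component ι φ (totalDistribution D) x v ∈ D i x) :
    ∀ v ∈ D i x, tangentialPhi ι φ x v ∈ D i x := by
  rwa [h.component_eq hD hx] at hf

lemma sq_tangentialPhi_of_slant (h : IsEpsStructureAlong (n := n) ι ε φ ξ)
    (hD : IsTangentDecompositionOn U ι ξ D) {i : Fin (k + 1)} {θ : M → ℝ}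
    (hs : IsPointwiseSlantOn U ι φ (D i) θ) {x : M} (hx : x ∈ U)
    (hf : ∀ v ∈ D i x, component ι φ (totalDistribution D) x v ∈ D i x)
    {v : TangentSpace (𝓡 n) x} (hv : v ∈ D i x) :
    tangentialPhi ι φ x (tangentialPhi ι φ x v) = (ε * Real.cos (θ x) ^ 2) • v :=
  (h x).sq_compression_of_subspaceAngle (hD.inner_field hx i) (h.tangentialPhi_mem hD hx hf)
    (hs.range x hx) (hs.slant x hx) hv

/-- An invariant distribution orthogonal to `ξ` on which the square of the tangential part of `φ`
is `ε cos² θ` satisfies the slant condition. -/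
lemma slant_of_sq_tangentialPhi (h : IsEpsStructureAlong (n := n) ι ε φ ξ)
    {S : ∀ x : M, Submodule ℝ (TangentSpace (𝓡 n) x)} {x : M}
    (hSξ : ∀ v ∈ S x, inner ℝ v (tangentialPart ι x (ξ (ι x))) = (0 : ℝ))
    (hS : ∀ v ∈ S x, tangentialPhi ι φ x v ∈ S x) {θ : ℝ} (hθ : θ ∈ Set.Ioc 0 (Real.pi / 2))
    (hsq : ∀ v ∈ S x, tangentialPhi ι φ x (tangentialPhi ι φ x v) = (ε * Real.cos θ ^ 2) • v)
    {v : TangentSpace (𝓡 n) x} (hv : v ∈ S x) (hv0 : v ≠ 0) :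
    phiTangent ι φ x v ≠ 0 ∧ subspaceAngle (phiTangent ι φ x v) (ambientFiber ι S x) = θ :=
  (h x).subspaceAngle_of_sq_compression hSξ hS hθ hsq hv hv0

end IsEpsStructureAlong

end

/-! ### Smooth fields and regular distributions -/

section

variable {n m : ℕ}
  {M : Type*} [TopologicalSpace M] [ChartedSpace (EuclideanSpace ℝ (Fin n)) M]
  [IsManifold (𝓡 n) ∞ M]
  [RiemannianBundle (fun x : M => TangentSpace (𝓡 n) x)]
  [IsContMDiffRiemannianBundle (𝓡 n) ∞ (EuclideanSpace ℝ (Fin n))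
    (fun x : M => TangentSpace (𝓡 n) x)]

/-- A vector field is smooth at the point `x`. -/
def SmoothFieldAt (X : ∀ x : M, TangentSpace (𝓡 n) x) (x : M) : Prop :=
  ContMDiffAt (𝓡 n) (𝓡 n).tangent ∞ (fun x => (⟨x, X x⟩ : TangentBundle (𝓡 n) M)) x

variable {X Y : ∀ x : M, TangentSpace (𝓡 n) x} {x : M} {U : Set M}

lemma SmoothField.smoothFieldAt (hX : SmoothField X) (x : M) : SmoothFieldAt X x :=
  ContMDiff.contMDiffAt hX

lemma SmoothFieldOn.smoothFieldAt (hX : SmoothFieldOn U X) (hU : IsOpen U) (hx : x ∈ U) :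
    SmoothFieldAt X x :=
  ContMDiffOn.contMDiffAt hX (hU.mem_nhds hx)

lemma SmoothFieldOn.mono {V : Set M} (hX : SmoothFieldOn U X) (h : V ⊆ U) : SmoothFieldOn V X :=
  ContMDiffOn.mono hX h

namespace SmoothFieldAt

lemma mdifferentiableAt (hX : SmoothFieldAt X x) :
    MDifferentiableAt (𝓡 n) (𝓡 n).tangent (fun y => (⟨y, X y⟩ : TangentBundle (𝓡 n) M)) x :=
  ContMDiffAt.mdifferentiableAt hX (by simp)

lemma congr (hX : SmoothFieldAt X x) (h : ∀ᶠ y in nhds x, Y y = X y) : SmoothFieldAt Y x :=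
  ContMDiffAt.congr_of_eventuallyEq hX (h.mono fun y hy => by simp only [hy])

lemma sub (hX : SmoothFieldAt X x) (hY : SmoothFieldAt Y x) :
    SmoothFieldAt (fun y => X y - Y y) x :=
  ContMDiffAt.sub_section hX hY

lemma smul {f : M → ℝ} (hf : ContMDiffAt (𝓡 n) 𝓘(ℝ) ∞ f x) (hX : SmoothFieldAt X x) :
    SmoothFieldAt (fun y => f y • X y) x :=
  ContMDiffAt.smul_section hf hX

lemma sum {κ : Type*} {s : Finset κ} {Z : κ → ∀ x : M, TangentSpace (𝓡 n) x}
    (hZ : ∀ i ∈ s, SmoothFieldAt (Z i) x) : SmoothFieldAt (fun y => ∑ i ∈ s, Z i y) x :=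
  ContMDiffAt.sum_section hZ

lemma inner_field (hX : SmoothFieldAt X x) (hY : SmoothFieldAt Y x) :
    ContMDiffAt (𝓡 n) 𝓘(ℝ) ∞ (fun y => (inner ℝ (X y) (Y y) : ℝ)) x :=
  ContMDiffAt.inner_bundle (E := fun x : M => TangentSpace (𝓡 n) x) hX hY

/-- Strong induction along the Gram–Schmidt recursion; independence at `x` keeps the denominators
from vanishing there. -/
lemma gramSchmidt {r : ℕ} {Z : Fin r → ∀ x : M, TangentSpace (𝓡 n) x}
    (hZ : ∀ i, SmoothFieldAt (Z i) x) (hli : LinearIndependent ℝ fun i => Z i x) (j : Fin r) :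
    SmoothFieldAt (fun y => InnerProductSpace.gramSchmidt ℝ (fun i => Z i y) j) x := by
  induction j using WellFoundedLT.induction with
  | ind j ih =>
    have h : (fun y => InnerProductSpace.gramSchmidt ℝ (fun i => Z i y) j) = fun y => Z j y -
        ∑ i ∈ Finset.Iio j,
          ((inner ℝ (InnerProductSpace.gramSchmidt ℝ (fun i => Z i y) i) (Z j y) : ℝ) /
            inner ℝ (InnerProductSpace.gramSchmidt ℝ (fun i => Z i y) i)
              (InnerProductSpace.gramSchmidt ℝ (fun i => Z i y) i)) •
            InnerProductSpace.gramSchmidt ℝ (fun i => Z i y) i := by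
      funext y
      rw [InnerProductSpace.gramSchmidt_def]
      simp only [Submodule.starProjection_singleton, real_inner_self_eq_norm_sq, RCLike.ofReal_real_eq_id, id]
    rw [h]
    refine (hZ j).sub (sum fun i hi => smul ?_ (ih i (Finset.mem_Iio.mp hi)))
    have hi' := ih i (Finset.mem_Iio.mp hi)
    exact (hi'.inner_field (hZ j)).div₀ (hi'.inner_field hi')
      (inner_self_ne_zero.mpr (InnerProductSpace.gramSchmidt_ne_zero i hli))

lemma gramSchmidtNormed {r : ℕ} {Z : Fin r → ∀ x : M, TangentSpace (𝓡 n) x}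
    (hZ : ∀ i, SmoothFieldAt (Z i) x) (hli : LinearIndependent ℝ fun i => Z i x) (j : Fin r) :
    SmoothFieldAt (fun y => InnerProductSpace.gramSchmidtNormed ℝ (fun i => Z i y) j) x := by
  have hg := gramSchmidt hZ hli j
  have hne : (inner ℝ (InnerProductSpace.gramSchmidt ℝ (fun i => Z i x) j)
      (InnerProductSpace.gramSchmidt ℝ (fun i => Z i x) j) : ℝ) ≠ 0 :=
    inner_self_ne_zero.mpr (InnerProductSpace.gramSchmidt_ne_zero j hli)
  have hs := (Real.contDiffAt_sqrt (n := ∞) hne).contMDiffAt.comp x (hg.inner_field hg)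
  refine (smul (hs.inv₀ ((Real.sqrt_ne_zero (real_inner_self_nonneg)).mpr hne)) hg).congr
    (Filter.Eventually.of_forall fun y => ?_)
  rw [InnerProductSpace.gramSchmidtNormed, norm_eq_sqrt_real_inner]
  rfl

end SmoothFieldAt

/-- A regular distribution has smooth local orthonormal frames. -/
lemma IsRegularDistributionOn.exists_orthonormal
    {S : ∀ x : M, Submodule ℝ (TangentSpace (𝓡 n) x)} (hS : IsRegularDistributionOn U S) :
    ∃ r : ℕ, ∀ x ∈ U, ∃ V : Set M, IsOpen V ∧ x ∈ V ∧ V ⊆ U ∧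
      ∃ e : Fin r → ∀ x : M, TangentSpace (𝓡 n) x,
        (∀ i, ∀ y ∈ V, SmoothFieldAt (e i) y) ∧
        ∀ y ∈ V, Orthonormal ℝ (fun i => e i y) ∧
          Submodule.span ℝ (Set.range fun i => e i y) = S y := by
  obtain ⟨r, h⟩ := hS
  refine ⟨r, fun x hx => ?_⟩
  obtain ⟨V, hV, hxV, hVU, Y, hY, hspan⟩ := h x hx
  refine ⟨V, hV, hxV, hVU, fun j y => InnerProductSpace.gramSchmidtNormed ℝ (fun i => Y i y) j,
    fun j y hy => SmoothFieldAt.gramSchmidtNormed (fun i => (hY i).smoothFieldAt hV hy)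
      (hspan y hy).1 j, fun y hy => ⟨InnerProductSpace.gramSchmidtNormed_orthonormal (hspan y hy).1,
      (span_range_gramSchmidtNormed fun i => Y i y).trans (hspan y hy).2⟩⟩

lemma IsRegularDistributionOn.mono {V : Set M}
    {S : ∀ x : M, Submodule ℝ (TangentSpace (𝓡 n) x)} (hS : IsRegularDistributionOn U S)
    (hV : IsOpen V) (hVU : V ⊆ U) : IsRegularDistributionOn V S := by
  obtain ⟨r, h⟩ := hS
  refine ⟨r, fun x hx => ?_⟩
  obtain ⟨V', hV', hxV, -, Y, hY, hspan⟩ := h x (hVU hx)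
  exact ⟨V' ∩ V, hV'.inter hV, ⟨hxV, hx⟩, Set.inter_subset_right, Y,
    fun i => (hY i).mono Set.inter_subset_left, fun y hy => hspan y hy.1⟩

lemma IsRegularDistributionOn.bot (hU : IsOpen U) :
    IsRegularDistributionOn U (fun x : M => (⊥ : Submodule ℝ (TangentSpace (𝓡 n) x))) :=
  ⟨0, fun x hx => ⟨U, hU, hx, subset_rfl, fun i => i.elim0, fun i => i.elim0, fun y _ =>
    ⟨linearIndependent_empty_type, by simp⟩⟩⟩

lemma IsRegularDistributionOn.sup {S T : ∀ x : M, Submodule ℝ (TangentSpace (𝓡 n) x)}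
    (hS : IsRegularDistributionOn U S) (hT : IsRegularDistributionOn U T)
    (hST : ∀ x ∈ U, S x ⟂ T x) : IsRegularDistributionOn U (fun x => S x ⊔ T x) := by
  obtain ⟨r, hr⟩ := hS
  obtain ⟨s, hs⟩ := hT
  refine ⟨r + s, fun x hx => ?_⟩
  obtain ⟨V, hV, hxV, hVU, Y, hY, hYS⟩ := hr x hx
  obtain ⟨V', hV', hxV', -, Z, hZ, hZT⟩ := hs x hx
  refine ⟨V ∩ V', hV.inter hV', ⟨hxV, hxV'⟩, Set.inter_subset_left.trans hVU,
    fun i => Sum.elim Y Z (finSumFinEquiv.symm i), fun i => ?_, fun y hy => ?_⟩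
  · beta_reduce
    generalize finSumFinEquiv.symm i = j
    cases j with
    | inl j => exact (hY j).mono Set.inter_subset_left
    | inr j => exact (hZ j).mono Set.inter_subset_right
  · obtain ⟨hli, hsp⟩ := hYS y hy.1
    obtain ⟨hli', hsp'⟩ := hZT y hy.2
    have he : (fun i => Sum.elim Y Z (finSumFinEquiv.symm i) y) =
        Sum.elim (fun i => Y i y) (fun i => Z i y) ∘ finSumFinEquiv.symm := by
      funext i
      simp only [Function.comp_apply]
      generalize finSumFinEquiv.symm i = j
      cases j <;> rfl
    rw [he]
    constructor
    · refine (linearIndependent_equiv _).mpr (hli.sum_type hli' ?_)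
      rw [hsp, hsp']
      exact (hST y (hVU hy.1)).disjoint
    · rw [EquivLike.range_comp, Set.Sum.elim_range, Submodule.span_union, hsp, hsp']

lemma IsRegularDistributionOn.iSup {κ : Type*} [Fintype κ]
    {S : κ → ∀ x : M, Submodule ℝ (TangentSpace (𝓡 n) x)} (hU : IsOpen U)
    (hS : ∀ i, IsRegularDistributionOn U (S i))
    (hST : ∀ x ∈ U, ∀ i j, i ≠ j → S i x ⟂ S j x) :
    IsRegularDistributionOn U (fun x => ⨆ i, S i x) := by
  classical
  suffices h : ∀ s : Finset κ, IsRegularDistributionOn U (fun x => ⨆ i ∈ s, S i x) by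
    simpa using h Finset.univ
  intro s
  induction s using Finset.induction_on with
  | empty => simpa using IsRegularDistributionOn.bot hU
  | insert a s ha ih =>
    simp only [Finset.iSup_insert]
    refine (hS a).sup ih fun x hx => ?_
    rw [Submodule.isOrtho_iSup_right]
    intro i
    rw [Submodule.isOrtho_iSup_right]
    exact fun hi => hST x hx a i (by rintro rfl; exact ha hi)

/-- The rank is one number for all of `U`, so being nonzero at one point is being nonzero
everywhere. -/
lemma IsRegularDistributionOn.ne_bot {S : ∀ x : M, Submodule ℝ (TangentSpace (𝓡 n) x)}
    (hS : IsRegularDistributionOn U S) (h : ∃ x ∈ U, S x ≠ ⊥) : ∀ x ∈ U, S x ≠ ⊥ := by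
  obtain ⟨r, hr⟩ := hS
  have key : ∀ x ∈ U, S x = ⊥ ↔ r = 0 := by
    intro x hx
    obtain ⟨V, -, hxV, -, Y, -, hspan⟩ := hr x hx
    have := finrank_span_eq_card (hspan x hxV).1
    rw [(hspan x hxV).2, Fintype.card_fin] at this
    rw [← this, Submodule.finrank_eq_zero]
  obtain ⟨x, hx, hne⟩ := h
  intro y hy
  rw [Ne, key y hy, ← key x hx]
  exact hne

/-- In a smooth local orthonormal frame the projection is `∑ ⟪e_i, X⟫ e_i`. -/
lemma SmoothField.starProjection {S : ∀ x : M, Submodule ℝ (TangentSpace (𝓡 n) x)}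
    (hS : IsRegularDistributionOn Set.univ S) (hX : SmoothField X) :
    SmoothField (fun x => (S x).starProjection (X x)) := by
  intro x
  obtain ⟨r, hr⟩ := hS.exists_orthonormal
  obtain ⟨V, hV, hxV, -, e, he, hspan⟩ := hr x trivial
  refine SmoothFieldAt.congr (X := fun y => ∑ i, (inner ℝ (e i y) (X y) : ℝ) • e i y)
    (SmoothFieldAt.sum fun i _ => SmoothFieldAt.smul
      ((he i x hxV).inner_field (hX.smoothFieldAt x)) (he i x hxV))
    (Filter.eventually_of_mem (hV.mem_nhds hxV) fun y hy => ?_)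
  exact starProjection_span_range_of_orthonormal (hspan y hy).1 (hspan y hy).2 _

/-- Vector fields which are smooth and tangent to a distribution near `x` are extended to `M`,
without a change at `x`. -/
lemma exists_smoothField_eq [T2Space M] {S : ∀ x : M, Submodule ℝ (TangentSpace (𝓡 n) x)}
    {V : Set M} (hV : IsOpen V) (hx : x ∈ V) (hX : ∀ y ∈ V, SmoothFieldAt X y)
    (hXS : ∀ y ∈ V, X y ∈ S y) :
    ∃ Y : ∀ x : M, TangentSpace (𝓡 n) x, SmoothField Y ∧ (∀ y, Y y ∈ S y) ∧ Y x = X x := by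
  obtain ⟨f, -, hf⟩ := ((SmoothBumpFunction.nhds_basis_tsupport (I := 𝓡 n) x).mem_iff).mp
    (hV.mem_nhds hx)
  refine ⟨fun y => f y • X y, ContMDiffOn.smul_section_of_tsupport f.contMDiff.contMDiffOn hV hf
    fun y hy => ContMDiffAt.contMDiffWithinAt (hX y hy), fun y => ?_, by simp⟩
  by_cases hy : y ∈ V
  · exact (S y).smul_mem _ (hXS y hy)
  · beta_reduce
    rw [image_eq_zero_of_notMem_tsupport fun h => hy (hf h), zero_smul]
    exact zero_mem _

/-- Assertions 1) and 2) i) quantify over global fields only; this makes every tangent vector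
available as a value of `X`. -/
lemma exists_smoothField_eq_vector [T2Space M] (v : TangentSpace (𝓡 n) x) :
    ∃ X : ∀ x : M, TangentSpace (𝓡 n) x, SmoothField X ∧ X x = v := by
  have : ContMDiffVectorBundle ∞ (EuclideanSpace ℝ (Fin n))
      (TangentSpace (𝓡 n) : M → Type _) (𝓡 n) :=
    have : IsManifold (𝓡 n) (∞ + 1) M := .of_le (n := ∞) (by norm_cast)
    TangentBundle.contMDiffVectorBundle
  obtain ⟨s, hs, hX⟩ := FiberBundle.exists_contMDiffOn_extend (k := ∞) (𝓡 n)
    (EuclideanSpace ℝ (Fin n)) v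
  obtain ⟨V, hVs, hV, hxV⟩ := mem_nhds_iff.mp hs
  obtain ⟨Y, hY, -, hYx⟩ := exists_smoothField_eq (S := fun _ => ⊤) hV hxV
    (fun y hy => ContMDiffOn.contMDiffAt hX (Filter.mem_of_superset (hV.mem_nhds hy) hVs))
    (fun y _ => trivial)
  exact ⟨Y, hY, by rw [hYx, FiberBundle.extend_apply_self]⟩

/-- A differentiable function whose differential vanishes everywhere is locally constant. -/
lemma isLocallyConstant_of_mvfderiv_eq_zero {f : M → ℝ} (hf : MDifferentiable (𝓡 n) 𝓘(ℝ) f)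
    (h : ∀ x, mvfderiv (𝓡 n) f x = 0) : IsLocallyConstant f := by
  refine IsLocallyConstant.iff_eventually_eq _ |>.mpr fun x => ?_
  let c := chartAt (EuclideanSpace ℝ (Fin n)) x
  have hd : ∀ z ∈ c.target, HasFDerivAt (f ∘ c.symm) (0 : EuclideanSpace ℝ (Fin n) →L[ℝ] ℝ) z := by
    intro z hz
    have h1 : HasMFDerivAt (𝓡 n) 𝓘(ℝ) f (c.symm z) 0 := by
      have h2 : mfderiv (𝓡 n) 𝓘(ℝ) f (c.symm z) = 0 := h (c.symm z)
      rw [← h2]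
      exact (hf _).hasMFDerivAt
    have h3 : MDifferentiableAt (𝓡 n) (𝓡 n) c.symm z :=
      mdifferentiableAt_atlas_symm (chart_mem_atlas _ x) hz
    have h4 := h1.comp z h3.hasMFDerivAt
    rw [ContinuousLinearMap.zero_comp] at h4
    exact h4.hasFDerivAt
  -- In a chart the derivative vanishes on an open set, where level sets are therefore open.
  have hopen : IsOpen (c.target ∩ (f ∘ c.symm) ⁻¹' {f x}) :=
    c.open_target.isOpen_inter_preimage_of_fderiv_eq_zero
      (fun z hz => (hd z hz).differentiableAt.differentiableWithinAt)
      (fun z hz => (hd z hz).fderiv) _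
  have hmem : c x ∈ c.target ∩ (f ∘ c.symm) ⁻¹' {f x} :=
    ⟨c.map_source (mem_chart_source _ x), by
      simp [c.left_inv (mem_chart_source _ x)]⟩
  filter_upwards [(c.continuousAt (mem_chart_source _ x)) (hopen.mem_nhds hmem),
    c.open_source.mem_nhds (mem_chart_source _ x)] with y hy hys
  have := hy.2
  rwa [Set.mem_preimage, Function.comp_apply, c.left_inv hys] at this

end

/-! ### The eigenvalues of `f²` -/

section

variable {n m : ℕ}
  {M : Type*} [TopologicalSpace M] [ChartedSpace (EuclideanSpace ℝ (Fin n)) M]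
  [IsManifold (𝓡 n) ∞ M]
  [RiemannianBundle (fun x : M => TangentSpace (𝓡 n) x)]
  [IsContMDiffRiemannianBundle (𝓡 n) ∞ (EuclideanSpace ℝ (Fin n))
    (fun x : M => TangentSpace (𝓡 n) x)]
  {N : Type*} [TopologicalSpace N] [ChartedSpace (EuclideanSpace ℝ (Fin m)) N]
  [IsManifold (𝓡 m) ∞ N]
  [RiemannianBundle (fun y : N => TangentSpace (𝓡 m) y)]
  [IsContMDiffRiemannianBundle (𝓡 m) ∞ (EuclideanSpace ℝ (Fin m))
    (fun y : N => TangentSpace (𝓡 m) y)]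
  {ι : M → N} {ε : ℝ} {φ : ∀ y : N, TangentSpace (𝓡 m) y →L[ℝ] TangentSpace (𝓡 m) y}
  {ξ : ∀ y : N, TangentSpace (𝓡 m) y}

lemma contMDiffAt_mfderiv_apply (hι : IsIsometricImmersion (n := n) (m := m) ι)
    {X : ∀ x : M, TangentSpace (𝓡 n) x} {x : M} (hX : SmoothFieldAt X x) :
    ContMDiffAt (𝓡 n) (𝓡 m).tangent ∞
      (fun y => (⟨ι y, mfderiv (𝓡 n) (𝓡 m) ι y (X y)⟩ : TangentBundle (𝓡 m) N)) x :=
  ((hι.contMDiff.contMDiff_tangentMap (m := ∞) (by norm_cast)).contMDiffAt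
    (x := (⟨x, X x⟩ : TangentBundle (𝓡 n) M))).comp x hX

/-- The coefficients of `T` in smooth fields are `⟪φ(dι X), dι Y⟫`. Their smoothness is all that is
needed, so `T` is not treated as a section of an endomorphism bundle. -/
lemma contMDiffAt_inner_tangentialPhi (hι : IsIsometricImmersion (n := n) (m := m) ι)
    (hφ : SmoothEndo φ) {X Y : ∀ x : M, TangentSpace (𝓡 n) x} {x : M} (hX : SmoothFieldAt X x)
    (hY : SmoothFieldAt Y x) :
    ContMDiffAt (𝓡 n) 𝓘(ℝ) ∞ (fun y => (inner ℝ (tangentialPhi ι φ y (X y)) (Y y) : ℝ)) x := by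
  have h1 := ContMDiffAt.clm_bundle_apply (b := ι) (ϕ := fun y => φ (ι y))
    (E₁ := fun y : N => TangentSpace (𝓡 m) y) (E₂ := fun y : N => TangentSpace (𝓡 m) y)
    ((ContMDiff.contMDiffAt hφ).comp x hι.contMDiff.contMDiffAt) (contMDiffAt_mfderiv_apply hι hX)
  have h2 := ContMDiffAt.inner_bundle (E := fun y : N => TangentSpace (𝓡 m) y) h1
    (contMDiffAt_mfderiv_apply hι hY)
  refine h2.congr_of_eventuallyEq (Filter.Eventually.of_forall fun y => ?_)
  exact inner_compression_left _ _

variable {k : ℕ} {D : Fin (k + 1) → ∀ x : M, Submodule ℝ (TangentSpace (𝓡 n) x)}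
  {θ : Fin k → M → ℝ}

namespace IsKPointwiseSlantSubmanifold

lemma component_eq (hM : IsKPointwiseSlantSubmanifold ι φ ξ D θ)
    (h : IsEpsStructureAlong (n := n) ι ε φ ξ) :
    component ι φ (totalDistribution D) = tangentialPhi ι φ :=
  funext fun _ => h.component_eq hM.2 trivial

lemma tangentialPhi_mem (hM : IsKPointwiseSlantSubmanifold ι φ ξ D θ)
    (h : IsEpsStructureAlong (n := n) ι ε φ ξ) (i : Fin k) {x : M} {v : TangentSpace (𝓡 n) x}
    (hv : v ∈ D i.succ x) : tangentialPhi ι φ x v ∈ D i.succ x :=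
  h.tangentialPhi_mem hM.2 trivial (hM.1.component_mem i x trivial) v hv

lemma sq_tangentialPhi (hM : IsKPointwiseSlantSubmanifold ι φ ξ D θ)
    (h : IsEpsStructureAlong (n := n) ι ε φ ξ) (i : Fin k) {x : M} {v : TangentSpace (𝓡 n) x}
    (hv : v ∈ D i.succ x) :
    tangentialPhi ι φ x (tangentialPhi ι φ x v) = slantEigenvalue ε θ i x • v :=
  h.sq_tangentialPhi_of_slant hM.2 (hM.1.slant i) trivial (hM.1.component_mem i x trivial) hv

lemma ne_bot (hM : IsKPointwiseSlantSubmanifold ι φ ξ D θ) (i : Fin k) (x : M) :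
    D i.succ x ≠ ⊥ :=
  (hM.1.regular i.succ).ne_bot (hM.1.slant i).nonnull x trivial

/-- Near each point, `D_i` has a nonempty smooth orthonormal frame. -/
lemma exists_orthonormal (hM : IsKPointwiseSlantSubmanifold ι φ ξ D θ) (i : Fin k) (x : M) :
    ∃ r : ℕ, ∃ V : Set M, IsOpen V ∧ x ∈ V ∧ ∃ e : Fin (r + 1) → ∀ x : M, TangentSpace (𝓡 n) x,
      (∀ j, ∀ y ∈ V, SmoothFieldAt (e j) y) ∧
      ∀ y ∈ V, Orthonormal ℝ (fun j => e j y) ∧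
        Submodule.span ℝ (Set.range fun j => e j y) = D i.succ y := by
  obtain ⟨r, hr⟩ := (hM.1.regular i.succ).exists_orthonormal
  obtain ⟨V, hV, hxV, -, e, he, hspan⟩ := hr x trivial
  cases r with
  -- Rank zero is excluded by non-nullity, so a frame vector `e 0` is available later.
  | zero =>
    refine absurd ?_ (hM.ne_bot i x)
    rw [← (hspan x hxV).2, Set.range_eq_empty, Submodule.span_empty]
  | succ r => exact ⟨r, V, hV, hxV, e, he, hspan⟩

/-- The eigenvalues of `f²` are smooth functions. -/
lemma contMDiff_slantEigenvalue (hM : IsKPointwiseSlantSubmanifold ι φ ξ D θ)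
    (h : IsEpsStructureAlong (n := n) ι ε φ ξ) (hι : IsIsometricImmersion (n := n) (m := m) ι)
    (hφ : SmoothEndo φ) (i : Fin k) : ContMDiff (𝓡 n) 𝓘(ℝ) ∞ (slantEigenvalue ε θ i) := by
  intro x
  obtain ⟨r, V, hV, hxV, e, he, hspan⟩ := hM.exists_orthonormal i x
  -- The slant functions are only continuous, but `λ_i = ε ‖T e₀‖²`, and invariance of `D_i` lets `T
  -- e₀` be expanded in the frame of `D_i`.
  have hsmooth : ContMDiffAt (𝓡 n) 𝓘(ℝ) ∞ (fun y => ε * ∑ j,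
      (inner ℝ (tangentialPhi ι φ y (e 0 y)) (e j y) : ℝ) ^ 2) x :=
    contMDiffAt_const.mul (contMDiffAt_finsetSum fun j _ =>
      (contMDiffAt_inner_tangentialPhi hι hφ (he 0 x hxV) (he j x hxV)).pow 2)
  refine hsmooth.congr_of_eventuallyEq (Filter.eventually_of_mem (hV.mem_nhds hxV) fun y hy => ?_)
  obtain ⟨hon, hsp⟩ := hspan y hy
  have he0 : e 0 y ∈ D i.succ y := hsp ▸ Submodule.subset_span (Set.mem_range_self 0)
  have hproj := starProjection_span_range_of_orthonormal hon hsp (tangentialPhi ι φ y (e 0 y))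
  rw [Submodule.starProjection_eq_self_iff.mpr (hM.tangentialPhi_mem h i he0)] at hproj
  have hsq : (inner ℝ (tangentialPhi ι φ y (e 0 y)) (tangentialPhi ι φ y (e 0 y)) : ℝ) =
      ∑ j, (inner ℝ (tangentialPhi ι φ y (e 0 y)) (e j y) : ℝ) ^ 2 := by
    conv_lhs => rw [hproj]
    rw [sum_inner]
    refine Finset.sum_congr rfl fun j _ => ?_
    rw [real_inner_smul_left, ← hproj, real_inner_comm, sq]
  have hinner := (h y).inner_compression (e 0 y) (tangentialPhi ι φ y (e 0 y))
  have h1 : (inner ℝ (e 0 y) (e 0 y) : ℝ) = 1 := by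
    rw [real_inner_self_eq_norm_sq, hon.1 0, one_pow]
  change (inner ℝ (tangentialPhi ι φ y (e 0 y)) (tangentialPhi ι φ y (e 0 y)) : ℝ) =
    ε * inner ℝ (e 0 y) (tangentialPhi ι φ y (tangentialPhi ι φ y (e 0 y))) at hinner
  rw [hM.sq_tangentialPhi h i he0, real_inner_smul_right, h1] at hinner
  beta_reduce
  rw [← hsq, hinner, mul_one, ← mul_assoc, (h y).eps, one_mul]

lemma mdifferentiable_slantEigenvalue (hM : IsKPointwiseSlantSubmanifold ι φ ξ D θ)
    (h : IsEpsStructureAlong (n := n) ι ε φ ξ) (hι : IsIsometricImmersion (n := n) (m := m) ι)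
    (hφ : SmoothEndo φ) (i : Fin k) :
    MDifferentiable (𝓡 n) 𝓘(ℝ) (slantEigenvalue ε θ i) :=
  (hM.contMDiff_slantEigenvalue h hι hφ i).mdifferentiable (by simp)

end IsKPointwiseSlantSubmanifold

lemma leviCivita_smul {Y : ∀ x : M, TangentSpace (𝓡 n) x} (hY : SmoothField Y) {f : M → ℝ}
    {x : M} (hf : MDifferentiableAt (𝓡 n) 𝓘(ℝ) f x) (v : TangentSpace (𝓡 n) x) :
    leviCivita (𝓡 n) (fun y => f y • Y y) x v =
      f x • leviCivita (𝓡 n) Y x v + mvfderiv (𝓡 n) f x v • Y x := by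
  have := isCovariantDerivativeOn_leviCivita.leibniz (hY.smoothFieldAt x).mdifferentiableAt hf
  exact congrArg (fun A => A v) this

lemma leviCivita_zero (x : M) :
    leviCivita (𝓡 n) (fun y => (0 : TangentSpace (𝓡 n) y)) x = 0 := by
  have h0 : SmoothField (fun y : M => (0 : TangentSpace (𝓡 n) y)) :=
    contMDiff_zeroSection _ _
  ext1 v
  have := leviCivita_smul h0 (f := fun _ => 0) (x := x) mdifferentiableAt_const v
  simpa using this

lemma leviCivita_sum {κ : Type*} (s : Finset κ) {Y : κ → ∀ x : M, TangentSpace (𝓡 n) x} {x : M}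
    (hY : ∀ i, SmoothFieldAt (Y i) x) :
    leviCivita (𝓡 n) (fun y => ∑ i ∈ s, Y i y) x = ∑ i ∈ s, leviCivita (𝓡 n) (Y i) x := by
  classical
  induction s using Finset.induction_on with
  | empty => simpa using leviCivita_zero x
  | insert a s ha ih =>
    simp only [Finset.sum_insert ha]
    rw [← ih]
    exact isCovariantDerivativeOn_leviCivita.add (hY a).mdifferentiableAt
      (SmoothFieldAt.sum fun i _ => hY i).mdifferentiableAt

namespace IsKPointwiseSlantSubmanifold

/-- Along `D_i` the field `f² Y` is `λ_i Y`, to which the Leibniz rule applies. -/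
lemma covDerivSq_eq (hM : IsKPointwiseSlantSubmanifold ι φ ξ D θ)
    (h : IsEpsStructureAlong (n := n) ι ε φ ξ) (hι : IsIsometricImmersion (n := n) (m := m) ι)
    (hφ : SmoothEndo φ) (i : Fin k) {X Y : ∀ x : M, TangentSpace (𝓡 n) x} (hY : SmoothField Y)
    (hYD : ∀ x, Y x ∈ D i.succ x) (x : M) :
    covDerivSq (component ι φ (totalDistribution D)) X Y x =
      slantEigenvalue ε θ i x • leviCivita (𝓡 n) Y x (X x) +
        mvfderiv (𝓡 n) (slantEigenvalue ε θ i) x (X x) • Y x -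
        tangentialPhi ι φ x (tangentialPhi ι φ x (leviCivita (𝓡 n) Y x (X x))) := by
  rw [covDerivSq, hM.component_eq h]
  simp only [hM.sq_tangentialPhi h i (hYD _)]
  rw [leviCivita_smul hY (hM.mdifferentiable_slantEigenvalue h hι hφ i x)]

/-- Take `Y ∈ D_i` of norm one at `x` and pair `(∇_X f²) Y = 0` with `Y`: by symmetry `⟪f² ∇_X Y, Y⟫
= λ_i ⟪∇_X Y, Y⟫`, so only `X(λ_i)` is left. -/
lemma mvfderiv_slantEigenvalue_eq_zero [T2Space M] (hM : IsKPointwiseSlantSubmanifold ι φ ξ D θ)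
    (h : IsEpsStructureAlong (n := n) ι ε φ ξ) (hι : IsIsometricImmersion (n := n) (m := m) ι)
    (hφ : SmoothEndo φ) (hpar : IsSqParallel ι φ D) (i : Fin k) (x : M) :
    mvfderiv (𝓡 n) (slantEigenvalue ε θ i) x = 0 := by
  ext1 v
  obtain ⟨r, V, hV, hxV, e, he, hspan⟩ := hM.exists_orthonormal i x
  obtain ⟨Y, hY, hYD, hYx⟩ := exists_smoothField_eq (S := D i.succ) hV hxV (he 0) fun y hy =>
    (hspan y hy).2 ▸ Submodule.subset_span (Set.mem_range_self 0)
  obtain ⟨X, hX, rfl⟩ := exists_smoothField_eq_vector v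
  have hz := hpar X Y hX hY (fun y => Submodule.mem_iSup_of_mem i (hYD y)) x
  rw [hM.covDerivSq_eq h hι hφ i hY hYD] at hz
  have h1 : (inner ℝ (Y x) (Y x) : ℝ) = 1 := by
    rw [real_inner_self_eq_norm_sq, hYx, (hspan x hxV).1.1 0, one_pow]
  have := congrArg (fun w => (inner ℝ w (Y x) : ℝ)) hz
  rw [inner_sub_left, inner_add_left, h.inner_sq_tangentialPhi,
    hM.sq_tangentialPhi h i (hYD x), real_inner_smul_left, real_inner_smul_left,
    real_inner_smul_right, h1, inner_zero_left] at this
  rw [zero_apply]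
  linarith

lemma isLocallyConstant_of_isSqParallel [T2Space M]
    (hM : IsKPointwiseSlantSubmanifold ι φ ξ D θ)
    (h : IsEpsStructureAlong (n := n) ι ε φ ξ) (hι : IsIsometricImmersion (n := n) (m := m) ι)
    (hφ : SmoothEndo φ) (hpar : IsSqParallel ι φ D) (i : Fin k) :
    IsLocallyConstant (slantEigenvalue ε θ i) :=
  isLocallyConstant_of_mvfderiv_eq_zero (hM.mdifferentiable_slantEigenvalue h hι hφ i)
    (hM.mvfderiv_slantEigenvalue_eq_zero h hι hφ hpar i)

lemma isCovDerivEigen_of_isSqParallel [T2Space M]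
    (hM : IsKPointwiseSlantSubmanifold ι φ ξ D θ)
    (h : IsEpsStructureAlong (n := n) ι ε φ ξ) (hι : IsIsometricImmersion (n := n) (m := m) ι)
    (hφ : SmoothEndo φ) (hpar : IsSqParallel ι φ D) : IsCovDerivEigen ι ε φ D θ := by
  intro i X Y hX hY hYD x
  have hz := hpar X Y hX hY (fun y => Submodule.mem_iSup_of_mem i (hYD y)) x
  rw [hM.covDerivSq_eq h hι hφ i hY hYD,
    hM.mvfderiv_slantEigenvalue_eq_zero h hι hφ hpar, zero_apply, zero_smul, add_zero,
    sub_eq_zero] at hz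
  rw [hM.component_eq h]
  exact hz.symm

lemma orthogonalFamily (hM : IsKPointwiseSlantSubmanifold ι φ ξ D θ) (x : M) :
    OrthogonalFamily ℝ (fun i : Fin k => D i.succ x) fun i => (D i.succ x).subtypeₗᵢ :=
  OrthogonalFamily.of_pairwise fun _ _ hij => hM.1.orthogonal x trivial _ _
    fun h => hij (Fin.succ_injective _ h)

lemma isSqParallel_of_isLocallyConstant
    (hM : IsKPointwiseSlantSubmanifold ι φ ξ D θ)
    (h : IsEpsStructureAlong (n := n) ι ε φ ξ)
    (hcov : IsCovDerivEigen ι ε φ D θ)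
    (hloc : ∀ i, IsLocallyConstant (slantEigenvalue ε θ i)) : IsSqParallel ι φ D := by
  intro X Y hX hY hYD x
  -- Assertion 2) i) speaks of fields in a single `D_i`, so `Y` is split into its projections, which
  -- are global smooth fields.
  let Z (i : Fin k) (y : M) : TangentSpace (𝓡 n) y := (D i.succ y).starProjection (Y y)
  have hZ (i : Fin k) : SmoothField (Z i) := hY.starProjection (hM.1.regular i.succ)
  have hZD (i : Fin k) (y : M) : Z i y ∈ D i.succ y := Submodule.starProjection_apply_mem _ _
  have hsum : Y = fun y => ∑ i, Z i y := funext fun y =>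
    ((hM.orthogonalFamily y).sum_projection_of_mem_iSup _ (hYD y)).symm
  have hconst (i : Fin k) : slantEigenvalue ε θ i =ᶠ[nhds x] fun _ => slantEigenvalue ε θ i x :=
    (IsLocallyConstant.iff_eventually_eq _).mp (hloc i) x
  have hmd (i : Fin k) : MDifferentiableAt (𝓡 n) 𝓘(ℝ) (slantEigenvalue ε θ i) x :=
    mdifferentiableAt_const.congr_of_eventuallyEq (hconst i)
  have hcmd (i : Fin k) : ContMDiffAt (𝓡 n) 𝓘(ℝ) ∞ (slantEigenvalue ε θ i) x :=
    contMDiffAt_const.congr_of_eventuallyEq (hconst i)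
  have hder (i : Fin k) : mvfderiv (𝓡 n) (slantEigenvalue ε θ i) x = 0 := by
    have h0 : mfderiv (𝓡 n) 𝓘(ℝ) (slantEigenvalue ε θ i) x = 0 := by
      rw [(hconst i).mfderiv_eq]
      exact mfderiv_const
    exact h0
  have hfsum : (fun y => tangentialPhi ι φ y (tangentialPhi ι φ y (Y y))) =
      fun y => ∑ i, slantEigenvalue ε θ i y • Z i y := by
    funext y
    conv_lhs => rw [hsum]
    simp only [map_sum, hM.sq_tangentialPhi h _ (hZD _ y)]
  rw [covDerivSq, hM.component_eq h, hfsum,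
    leviCivita_sum Finset.univ fun i => SmoothFieldAt.smul (hcmd i) ((hZ i).smoothFieldAt x)]
  conv_lhs => rw [hsum]
  rw [leviCivita_sum Finset.univ fun i => (hZ i).smoothFieldAt x, sub_eq_zero]
  simp only [sum_apply, map_sum]
  refine Finset.sum_congr rfl fun i _ => ?_
  rw [leviCivita_smul (hZ i) (hmd i), hder, zero_apply, zero_smul, add_zero]
  have := hcov i X (Z i) hX (hZ i) (hZD i) x
  rw [hM.component_eq h] at this
  exact this.symm

end IsKPointwiseSlantSubmanifold

end

/-! ### Slant submanifolds with constant eigenvalues -/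

section

variable {n m : ℕ}
  {M : Type*} [TopologicalSpace M] [ChartedSpace (EuclideanSpace ℝ (Fin n)) M]
  [IsManifold (𝓡 n) ∞ M]
  [RiemannianBundle (fun x : M => TangentSpace (𝓡 n) x)]
  [IsContMDiffRiemannianBundle (𝓡 n) ∞ (EuclideanSpace ℝ (Fin n))
    (fun x : M => TangentSpace (𝓡 n) x)]
  {N : Type*} [TopologicalSpace N] [ChartedSpace (EuclideanSpace ℝ (Fin m)) N]
  [IsManifold (𝓡 m) ∞ N]
  [RiemannianBundle (fun y : N => TangentSpace (𝓡 m) y)]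
  [IsContMDiffRiemannianBundle (𝓡 m) ∞ (EuclideanSpace ℝ (Fin m))
    (fun y : N => TangentSpace (𝓡 m) y)]
  {ι : M → N} {ε : ℝ} {φ : ∀ y : N, TangentSpace (𝓡 m) y →L[ℝ] TangentSpace (𝓡 m) y}
  {ξ : ∀ y : N, TangentSpace (𝓡 m) y}
  {k : ℕ} {D : Fin (k + 1) → ∀ x : M, Submodule ℝ (TangentSpace (𝓡 n) x)}
  {θ : Fin k → M → ℝ}

namespace IsKPointwiseSlantSubmanifold

lemma continuous_slantEigenvalue (hM : IsKPointwiseSlantSubmanifold ι φ ξ D θ) (ε : ℝ)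
    (i : Fin k) : Continuous (slantEigenvalue ε θ i) :=
  continuous_const.mul
    ((Real.continuous_cos.comp (continuousOn_univ.mp (hM.1.slant i).continuousOn)).pow 2)

/-- On a connected subset where `M` is a `k'`-slant submanifold, the eigenvalues are constant. -/
lemma slantEigenvalue_eq_of_isKSlantSubmanifoldOn (hM : IsKPointwiseSlantSubmanifold ι φ ξ D θ)
    (h : IsEpsStructureAlong (n := n) ι ε φ ξ) {U : Set M} (hU : IsPreconnected U) {k' : ℕ}
    (hs : IsKSlantSubmanifoldOn (n := n) U ι φ ξ k') (i : Fin k) {x y : M} (hx : x ∈ U)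
    (hy : y ∈ U) : slantEigenvalue ε θ i x = slantEigenvalue ε θ i y := by
  obtain ⟨D', θ', hD', hT'⟩ := hs
  -- The eigenvalues of `T²` on the second decomposition: `ε` on the invariant part, as there `T² =
  -- φ²`, and `ε cos² θ'_j` on the others.
  let μ : Fin (k' + 1) → ℝ := Fin.cons ε fun j => ε * Real.cos (θ' j) ^ 2
  have hμ : ∀ z ∈ U, ∀ j, ∀ v ∈ D' j z,
      tangentialPhi ι φ z (tangentialPhi ι φ z v) = μ j • v := by
    intro z hz j
    refine Fin.cases (fun v hv => ?_) (fun j v hv => ?_) j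
    · exact h.sq_tangentialPhi_of_invariant hT' hD'.invariant hz hv
    · exact h.sq_tangentialPhi_of_slant hT' (hD'.slant j) hz (hD'.component_mem j z hz) hv
  have hmaps : Set.MapsTo (slantEigenvalue ε θ i) U (Set.range μ) := by
    intro z hz
    obtain ⟨v, hv, hv0⟩ := Submodule.exists_mem_ne_zero_of_ne_bot (hM.ne_bot i z)
    exact exists_eigenvalue_eq_of_mem_iSup
      (A := fun v => tangentialPhi ι φ z (tangentialPhi ι φ z v))
      (h.inner_sq_tangentialPhi z) (hμ z hz)
      -- A vector of `D_i` is orthogonal to `ξ`, hence lies in the sum of the `D'_j`.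
      ((hT'.mem_total_iff hz).mpr (hM.2.inner_field trivial i.succ v hv)) hv0
      (hM.sq_tangentialPhi h i hv)
  -- A continuous function from a connected set to a finite, hence discrete, set is constant.
  exact hU.constant_of_mapsTo (Set.finite_range μ).isDiscrete
    (hM.continuous_slantEigenvalue ε i).continuousOn hmaps hx hy

/-- On an open subset where the eigenvalues are constant, the slant distributions with the same
eigenvalue are put together. -/
lemma isKSlantSubmanifoldOn_of_slantEigenvalue_eq
    (hM : IsKPointwiseSlantSubmanifold ι φ ξ D θ) (h : IsEpsStructureAlong (n := n) ι ε φ ξ)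
    {U : Set M} (hU : IsOpen U) {x : M} (hx : x ∈ U)
    (hconst : ∀ i, ∀ y ∈ U, slantEigenvalue ε θ i y = slantEigenvalue ε θ i x) :
    IsKSlantSubmanifoldOn (n := n) U ι φ ξ
      (Set.range fun i => slantEigenvalue ε θ i x).ncard := by
  obtain ⟨e⟩ : Nonempty (Fin (Set.range fun i => slantEigenvalue ε θ i x).ncard ≃
      Set.range fun i => slantEigenvalue ε θ i x) :=
    ⟨(Finite.equivFinOfCardEq (Nat.card_coe_set_eq _)).symm⟩
  -- For each distinct eigenvalue, `rep` picks an original index attaining it, which supplies the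
  -- slant angle of the merged distribution.
  choose rep hrep using fun j => (e j).2
  let κ (j) := {i : Fin k // slantEigenvalue ε θ i x = e j}
  let S (j) (y : M) : Submodule ℝ (TangentSpace (𝓡 n) y) := ⨆ i : κ j, D i.1.succ y
  let D' : Fin ((Set.range fun i => slantEigenvalue ε θ i x).ncard + 1) →
    ∀ y : M, Submodule ℝ (TangentSpace (𝓡 n) y) := Fin.cons (D 0) S
  have hS (j) : D' j.succ = S j := rfl
  have hle (i : Fin k) (y : M) : D i.succ y ≤ S (e.symm ⟨_, i, rfl⟩) y :=
    le_iSup (fun i' : κ (e.symm ⟨_, i, rfl⟩) => D i'.1.succ y) ⟨i, by simp⟩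
  have htotal (y : M) : totalDistribution D' y = totalDistribution D y := by
    refine le_antisymm (iSup_le fun j => ?_) (iSup_le fun i => ?_)
    · refine Fin.cases ?_ (fun j => ?_) j
      · exact le_iSup (fun i => D i y) 0
      · exact iSup_le fun i => le_iSup (fun i => D i y) i.1.succ
    · refine Fin.cases ?_ (fun i => ?_) i
      · exact le_iSup (fun j => D' j y) 0
      · exact (hle i y).trans (le_iSup (fun j => D' j y) (Fin.succ _))
  have hT' : IsTangentDecompositionOn U ι ξ D' := by
    intro y _
    refine ⟨fun j => ?_, by rw [htotal]; exact (hM.2 y trivial).2⟩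
    exact (le_iSup (fun j => D' j y) j).trans
      ((htotal y).le.trans (hM.2.isOrtho_total trivial))
  have hmem (j) (y : M) : ∀ v ∈ S j y, tangentialPhi ι φ y v ∈ S j y := by
    intro v hv
    induction hv using Submodule.iSup_induction' with
    | mem i w hw =>
      exact Submodule.mem_iSup_of_mem (p := fun i : κ j => D i.1.succ y) i
        (hM.tangentialPhi_mem h i.1 hw)
    | zero => simp
    | add a b _ _ ha hb => rw [map_add]; exact add_mem ha hb
  have hsq (j) (y : M) (hy : y ∈ U) (v) (hv : v ∈ S j y) :
      tangentialPhi ι φ y (tangentialPhi ι φ y v) = (e j : ℝ) • v := by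
    induction hv using Submodule.iSup_induction' with
    | mem i w hw => rw [hM.sq_tangentialPhi h i.1 hw, hconst i.1 y hy, i.2]
    | zero => simp
    | add a b _ _ ha hb => rw [map_add, map_add, ha, hb, smul_add]
  have hrep' (j) : ε * Real.cos (θ (rep j) x) ^ 2 = e j := hrep j
  refine ⟨D', fun j => θ (rep j) x, ⟨fun j => ?_, fun y hy i j hij => ?_, fun i j hij => ?_,
    fun j => ⟨⟨x, hx, fun hbot => ?_⟩, continuousOn_const,
      fun y _ => (hM.1.slant _).range x trivial, fun y hy v hv hv0 => ?_⟩,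
    fun y _ => hM.1.invariant y trivial, fun j y hy => ?_⟩, hT'⟩
  · refine Fin.cases ?_ (fun j => ?_) j
    · exact (hM.1.regular 0).mono hU (Set.subset_univ _)
    · exact IsRegularDistributionOn.iSup hU
        (fun i => (hM.1.regular _).mono hU (Set.subset_univ _))
        fun y _ a b hab => hM.1.orthogonal y trivial _ _
          fun hs => hab (Subtype.ext (Fin.succ_injective _ hs))
  · induction i using Fin.cases with
    | zero =>
      induction j using Fin.cases with
      | zero => exact absurd rfl hij
      | succ j =>
        exact Submodule.isOrtho_iSup_right.mpr fun b =>
          hM.1.orthogonal y trivial _ _ (Fin.succ_ne_zero _).symm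
    | succ i =>
      induction j using Fin.cases with
      | zero =>
        exact Submodule.isOrtho_iSup_left.mpr fun a =>
          hM.1.orthogonal y trivial _ _ (Fin.succ_ne_zero _)
      | succ j =>
        refine Submodule.isOrtho_iSup_left.mpr fun a => Submodule.isOrtho_iSup_right.mpr fun b =>
          hM.1.orthogonal y trivial _ _ fun hs => hij ?_
        have hab := Fin.succ_injective _ hs
        have : (e i : ℝ) = e j := by rw [← a.2, ← b.2, hab]
        rw [e.injective (Subtype.ext this)]
  · have : (e i : ℝ) = e j := by
      rw [← hrep' i, ← hrep' j]
      beta_reduce at hij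
      rw [hij]
    exact e.injective (Subtype.ext this)
  · refine hM.ne_bot (rep j) x (le_bot_iff.mp (le_trans ?_ hbot.le))
    exact le_iSup (fun i : κ j => D i.1.succ x) ⟨rep j, hrep j⟩
  · exact h.slant_of_sq_tangentialPhi (hT'.inner_field hy j.succ) (hmem j y)
      ((hM.1.slant _).range x trivial) (fun w hw => by rw [hrep' j, hsq j y hy w hw]) hv hv0
  -- The component into the merged decomposition is still `T`, which preserves each summand.
  · rw [h.component_eq hT' hy]
    exact hmem j y

/-- Constant eigenvalues are pairwise different, as the slant functions are. -/
lemma injective_of_slantEigenvalue_eq (hM : IsKPointwiseSlantSubmanifold ι φ ξ D θ)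
    (hε : ε * ε = 1) {c : Fin k → ℝ} (hc : ∀ i x, slantEigenvalue ε θ i x = c i) :
    Function.Injective c := by
  intro i j hij
  by_contra hne
  obtain ⟨x, -, hx⟩ := hM.1.distinct i j hne
  have hi := (hM.1.slant i).range x trivial
  have hj := (hM.1.slant j).range x trivial
  have hpi := Real.pi_pos
  have hε0 : ε ≠ 0 := by rintro rfl; simp at hε
  -- On `(0, π/2]` the cosine is nonnegative and injective, so equal eigenvalues at `x` would give
  -- equal angles, against the choice of `x`.
  have hcos : ε * Real.cos (θ i x) ^ 2 = ε * Real.cos (θ j x) ^ 2 :=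
    (hc i x).trans (hij.trans (hc j x).symm)
  have hcos' := (sq_eq_sq₀
    (Real.cos_nonneg_of_neg_pi_div_two_le_of_le (by linarith [hi.1]) hi.2)
    (Real.cos_nonneg_of_neg_pi_div_two_le_of_le (by linarith [hj.1]) hj.2)).mp
    (mul_left_cancel₀ hε0 hcos)
  exact hx (Real.injOn_cos ⟨hi.1.le, by linarith [hi.2]⟩ ⟨hj.1.le, by linarith [hj.2]⟩ hcos')

end IsKPointwiseSlantSubmanifold

end

theorem theoremp190 {n m : ℕ}
    {M : Type*} [TopologicalSpace M] [T2Space M] [SecondCountableTopology M]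
    [ChartedSpace (EuclideanSpace ℝ (Fin n)) M] [IsManifold (𝓡 n) ∞ M]
    [RiemannianBundle (fun x : M => TangentSpace (𝓡 n) x)]
    [IsContMDiffRiemannianBundle (𝓡 n) ∞ (EuclideanSpace ℝ (Fin n))
      (fun x : M => TangentSpace (𝓡 n) x)]
    {N : Type*} [TopologicalSpace N] [T2Space N] [SecondCountableTopology N]
    [ChartedSpace (EuclideanSpace ℝ (Fin m)) N] [IsManifold (𝓡 m) ∞ N]
    [RiemannianBundle (fun y : N => TangentSpace (𝓡 m) y)]
    [IsContMDiffRiemannianBundle (𝓡 m) ∞ (EuclideanSpace ℝ (Fin m))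
      (fun y : N => TangentSpace (𝓡 m) y)]
    (ι : M → N) (hι : IsIsometricImmersion (n := n) (m := m) ι)
    (ε : ℝ) (hε : ε = 1 ∨ ε = -1)
    (φ : ∀ y : N, TangentSpace (𝓡 m) y →L[ℝ] TangentSpace (𝓡 m) y)
    (ξ : ∀ y : N, TangentSpace (𝓡 m) y)
    -- either of the two settings; `ξ = 0` is the convention for the one without `ξ`
    (hstr : (IsAlmostEpsHermitian ε φ ∧ ∀ y, ξ y = 0) ∨
      (IsAlmostEpsContact ε φ ξ ∧ ∀ x : M, ξ (ι x) ∈ Set.range (mfderiv (𝓡 n) (𝓡 m) ι x)))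
    {k : ℕ} (hk : 1 ≤ k)
    (D : Fin (k + 1) → ∀ x : M, Submodule ℝ (TangentSpace (𝓡 n) x)) (θ : Fin k → M → ℝ)
    (hM : IsKPointwiseSlantSubmanifold ι φ ξ D θ) :
    -- the general case
    List.TFAE [
      IsSqParallel ι φ D,
      IsCovDerivEigen ι ε φ D θ ∧
        ∀ x : M, ∃ k' : ℕ, 1 ≤ k' ∧ k' ≤ k ∧
          IsKSlantSubmanifoldOn (n := n) (connectedComponent x) ι φ ξ k',
      IsCovDerivEigen ι ε φ D θ ∧
        ∀ x : M, (∀ i, ∀ y ∈ connectedComponent x,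
            slantEigenvalue ε θ i y = slantEigenvalue ε θ i x) ∧
          IsKSlantSubmanifoldOn (n := n) (connectedComponent x) ι φ ξ
            (Set.range fun i => slantEigenvalue ε θ i x).ncard] ∧
    -- the connected case
    (ConnectedSpace M → List.TFAE [
      IsSqParallel ι φ D,
      IsCovDerivEigen ι ε φ D θ ∧ IsKSlantSubmanifoldOn (n := n) (Set.univ : Set M) ι φ ξ k,
      IsCovDerivEigen ι ε φ D θ ∧ IsKSlantSubmanifoldOn (n := n) (Set.univ : Set M) ι φ ξ k ∧
        ∃ c : Fin k → ℝ, Function.Injective c ∧ ∀ i x, slantEigenvalue ε θ i x = c i]) := by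
  have h := isEpsStructureAlong (n := n) hι hε hstr
  have hφ : SmoothEndo φ := hstr.elim (fun h => h.1.smooth) fun h => h.1.smooth
  -- Connected components of a manifold are open, so being constant on them is being locally
  -- constant.
  have : LocallyConnectedSpace M :=
    ChartedSpace.locallyConnectedSpace (EuclideanSpace ℝ (Fin n)) M
  have one_le (x : M) : 1 ≤ (Set.range fun i => slantEigenvalue ε θ i x).ncard :=
    (Set.ncard_pos (Set.finite_range _)).mpr (Set.range_nonempty_iff_nonempty.mpr ⟨⟨0, hk⟩⟩)
  have le_k (x : M) : (Set.range fun i => slantEigenvalue ε θ i x).ncard ≤ k := by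
    rw [← Set.image_univ]
    exact (Set.ncard_image_le Set.finite_univ).trans (by simp)
  have hA : List.TFAE [
      IsSqParallel ι φ D,
      IsCovDerivEigen ι ε φ D θ ∧
        ∀ x : M, ∃ k' : ℕ, 1 ≤ k' ∧ k' ≤ k ∧
          IsKSlantSubmanifoldOn (n := n) (connectedComponent x) ι φ ξ k',
      IsCovDerivEigen ι ε φ D θ ∧
        ∀ x : M, (∀ i, ∀ y ∈ connectedComponent x,
            slantEigenvalue ε θ i y = slantEigenvalue ε θ i x) ∧
          IsKSlantSubmanifoldOn (n := n) (connectedComponent x) ι φ ξ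
            (Set.range fun i => slantEigenvalue ε θ i x).ncard] := by
    tfae_have 1 → 3 := by
      intro hpar
      refine ⟨hM.isCovDerivEigen_of_isSqParallel h hι hφ hpar, fun x => ?_⟩
      have hconst : ∀ i, ∀ y ∈ connectedComponent x,
          slantEigenvalue ε θ i y = slantEigenvalue ε θ i x := fun i y hy =>
        (hM.isLocallyConstant_of_isSqParallel h hι hφ hpar i).apply_eq_of_isPreconnected
          isPreconnected_connectedComponent hy mem_connectedComponent
      exact ⟨hconst, hM.isKSlantSubmanifoldOn_of_slantEigenvalue_eq h
        isOpen_connectedComponent mem_connectedComponent hconst⟩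
    tfae_have 3 → 2 := fun ⟨hcov, hx⟩ => ⟨hcov, fun x => ⟨_, one_le x, le_k x, (hx x).2⟩⟩
    tfae_have 2 → 1 := by
      rintro ⟨hcov, hslant⟩
      refine hM.isSqParallel_of_isLocallyConstant h hcov fun i => ?_
      refine (IsLocallyConstant.iff_eventually_eq _).mpr fun x => ?_
      obtain ⟨k', -, -, hs⟩ := hslant x
      exact Filter.eventually_of_mem
        (isOpen_connectedComponent.mem_nhds mem_connectedComponent) fun y hy =>
        hM.slantEigenvalue_eq_of_isKSlantSubmanifoldOn h isPreconnected_connectedComponent hs i hy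
          mem_connectedComponent
    tfae_finish
  refine ⟨hA, fun hconn => ?_⟩
  have huniv (x : M) : connectedComponent x = Set.univ :=
    PreconnectedSpace.connectedComponent_eq_univ x
  tfae_have 1 → 3 := by
    intro hpar
    obtain ⟨hcov, hx⟩ := (hA.out 0 2).mp hpar
    obtain ⟨x⟩ := hconn.toNonempty
    have hc : ∀ i y, slantEigenvalue ε θ i y = slantEigenvalue ε θ i x := fun i y =>
      (hx x).1 i y (by rw [huniv]; trivial)
    -- Injectivity turns the number of distinct eigenvalues, which is the `k'` of the general case,
    -- into `k`.
    have hinj := hM.injective_of_slantEigenvalue_eq (h x).eps hc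
    have hs := (hx x).2
    rw [huniv, ← Set.image_univ, Set.ncard_image_of_injective _ hinj, Set.ncard_univ,
      Nat.card_fin] at hs
    exact ⟨hcov, hs, _, hinj, hc⟩
  tfae_have 3 → 2 := fun hs => ⟨hs.1, hs.2.1⟩
  tfae_have 2 → 1 := by
    rintro ⟨hcov, hs⟩
    refine (hA.out 0 1).mpr ?_
    exact ⟨hcov, fun x => ⟨k, hk, le_rfl, by rw [huniv]; exact hs⟩⟩
  tfae_finish
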